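/- Let $A\in\mathbb R^{m\times m}$, $B\in\mathbb R^{m\times d}$, let $Q,X_0,W\in\mathbb R^{m\times m}$ and $R\in\mathbb R^{d\times d}$ be symmetric positive definite, and let $\beta\in\mathbb R\setminus\{0\}$. Consider the system $x_{t+1}=Ax_t+Bu_t+w_t$, $t\ge 0$, where $x_0\sim\mathcal N(0,X_0)$ and $w_t\sim\mathcal N(0,W)$, $t\ge0$, are jointly independent, with stage cost $c(x,u)=x^\top Qx+u^\top Ru$. A history-dependent policy is a sequence $\mu=(\mu_t)_{t\ge0}$ of Borel measurable maps $\mu_t:(\mathbb R^m\times\mathbb R^d)^t\times\mathbb R^m\to\mathbb R^d$, which generates the controls $u_t=\mu_t\big((x_0,u_0),\dots,(x_{t-1},u_{t-1}),x_t\big)$. Its objective is $$\mathcal J(\mu)=\lim_{T\to\infty}\frac1T\,\frac2\beta\,\log\mathbb E\exp\Big[\frac\beta2\sum_{t=0}^{T-1}c(x_t,u_t)\Big],$$ and it is called well-defined if this limit exists in $[-\infty,\infty]$ (an infinite expectation has logarithm $+\infty$). Suppose that the modified Riccati equation $$P=Q+K^\top RK+(A-BK)^\top\tilde P(A-BK),\qquad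 \tilde P=P+\beta P(W^{-1}-\beta P)^{-1}P,\qquad K=(R+B^\top\tilde PB)^{-1}B^\top\tilde PA$$ has a symmetric solution $P=P_{K^*}\ge0$, with associated $\tilde P=\tilde P_{K^*}$ and $K=K^*$, such that $W^{-1}-\beta P_{K^*}>0$ and which is stabilizing, i.e. $\rho\big((A-BK^*)^\top(I-\beta P_{K^*}W)^{-1}\big)<1$, where $\rho$ is the spectral radius. Put $\lambda^*=-\beta^{-1}\log\det(I-\beta P_{K^*}W)$. Then: 1. Every history-dependent policy $\mu$ with a well-defined objective satisfies $\mathcal J(\mu)\ge\lambda^*$. 2. If moreover $X_0^{-1}-\beta P_{K^*}>0$ (which is automatic for $\beta<0$), then the stationary linear state feedback $u_t=-K^*x_t$ has a well-defined objective, equal to $\lambda^*$. Hence $\mathcal J^*=\lambda^*$ is the minimum of $\mathcal J$ over all history-dependent policies with a well-defined objective, and it is attained by $u_t=-K^*x_t$. -/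

import Mathlib

open MeasureTheory ProbabilityTheory Filter Topology
open scoped Matrix

noncomputable section

namespace LEQG

/-- States (`n = m`) and controls (`n = d`) are Euclidean column vectors. -/
abbrev Vec (n : ℕ) := EuclideanSpace ℝ (Fin n)

/-- A deterministic history-dependent policy: at time `t` it maps the past state-action pairs
`(x_0, u_0), …, (x_{t-1}, u_{t-1})` and the current state `x_t` to the control `u_t`. -/
abbrev Policy (m d : ℕ) := (t : ℕ) → (Fin t → Vec m × Vec d) → Vec m → Vec d

/-- Every decision rule is (jointly) Borel measurable. -/
def Policy.IsMeasurable {m d : ℕ} (μ : Policy m d) : Prop :=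
  ∀ t, Measurable fun h : (Fin t → Vec m × Vec d) × Vec m => μ t h.1 h.2

/-- The stationary linear state feedback `u_t = -K x_t`. -/
def linearFeedback {m d : ℕ} (K : Matrix (Fin d) (Fin m) ℝ) : Policy m d :=
  fun _ _ x => WithLp.toLp 2 (-(K *ᵥ x.ofLp))

/-- The history at time `t` (past state-action pairs, current state) of the system
`x_{t+1} = A x_t + B u_t + w_t` started at `x₀` and driven by the policy `μ`. -/
def history {m d : ℕ} (A : Matrix (Fin m) (Fin m) ℝ) (B : Matrix (Fin m) (Fin d) ℝ)
    (μ : Policy m d) (x₀ : Vec m) (w : ℕ → Vec m) :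
    (t : ℕ) → (Fin t → Vec m × Vec d) × Vec m
  | 0 => (Fin.elim0, x₀)
  | t + 1 =>
    let h := history A B μ x₀ w t
    let u := μ t h.1 h.2
    (Fin.snoc (α := fun _ => Vec m × Vec d) h.1 (h.2, u),
      WithLp.toLp 2 (A *ᵥ h.2.ofLp + B *ᵥ u.ofLp) + w t)

/-- The state `x_t`. -/
def stateAt {m d : ℕ} (A : Matrix (Fin m) (Fin m) ℝ) (B : Matrix (Fin m) (Fin d) ℝ)
    (μ : Policy m d) (x₀ : Vec m) (w : ℕ → Vec m) (t : ℕ) : Vec m :=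
  (history A B μ x₀ w t).2

/-- The control `u_t`. -/
def controlAt {m d : ℕ} (A : Matrix (Fin m) (Fin m) ℝ) (B : Matrix (Fin m) (Fin d) ℝ)
    (μ : Policy m d) (x₀ : Vec m) (w : ℕ → Vec m) (t : ℕ) : Vec d :=
  μ t (history A B μ x₀ w t).1 (history A B μ x₀ w t).2

/-- The one-stage cost `c(x, u) = xᵀ Q x + uᵀ R u`. -/
def stageCost {m d : ℕ} (Q : Matrix (Fin m) (Fin m) ℝ) (R : Matrix (Fin d) (Fin d) ℝ)
    (x : Vec m) (u : Vec d) : ℝ :=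
  x.ofLp ⬝ᵥ (Q *ᵥ x.ofLp) + u.ofLp ⬝ᵥ (R *ᵥ u.ofLp)

/-- The `T`-stage objective
`(1/T) (2/β) log E exp[(β/2) ∑_{t<T} c(x_t, u_t)]`, as an extended real number: the expectation
is a Lebesgue integral with values in `[0, ∞]`, and `log ∞ = ∞`. -/
def finiteHorizonCost {m d : ℕ} (A : Matrix (Fin m) (Fin m) ℝ) (B : Matrix (Fin m) (Fin d) ℝ)
    (Q : Matrix (Fin m) (Fin m) ℝ) (R : Matrix (Fin d) (Fin d) ℝ) (β : ℝ)
    {Ω : Type*} [MeasurableSpace Ω] (Pr : Measure Ω) (x₀ : Ω → Vec m) (w : ℕ → Ω → Vec m)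
    (μ : Policy m d) (T : ℕ) : EReal :=
  ((1 / (T : ℝ) * (2 / β) : ℝ) : EReal) *
    ENNReal.log (∫⁻ ω, ENNReal.ofReal (Real.exp (β / 2 * ∑ t ∈ Finset.range T,
      stageCost Q R (stateAt A B μ (x₀ ω) (fun s => w s ω) t)
        (controlAt A B μ (x₀ ω) (fun s => w s ω) t))) ∂Pr)

/-- `J` is the long-run objective of the policy `μ`: the limit of the `T`-stage objectives exists
and equals `J`. -/
def HasObjective {m d : ℕ} (A : Matrix (Fin m) (Fin m) ℝ) (B : Matrix (Fin m) (Fin d) ℝ)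
    (Q : Matrix (Fin m) (Fin m) ℝ) (R : Matrix (Fin d) (Fin d) ℝ) (β : ℝ)
    {Ω : Type*} [MeasurableSpace Ω] (Pr : Measure Ω) (x₀ : Ω → Vec m) (w : ℕ → Ω → Vec m)
    (μ : Policy m d) (J : EReal) : Prop :=
  Tendsto (finiteHorizonCost A B Q R β Pr x₀ w μ) atTop (𝓝 J)

/-- `P̃ = P + β P (W⁻¹ - β P)⁻¹ P`. -/
def tildeP {m : ℕ} (W : Matrix (Fin m) (Fin m) ℝ) (β : ℝ) (P : Matrix (Fin m) (Fin m) ℝ) :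
    Matrix (Fin m) (Fin m) ℝ :=
  P + β • (P * (W⁻¹ - β • P)⁻¹ * P)

/-- The gain `(R + Bᵀ P̃ B)⁻¹ Bᵀ P̃ A`. -/
def riccatiGain {m d : ℕ} (A : Matrix (Fin m) (Fin m) ℝ) (B : Matrix (Fin m) (Fin d) ℝ)
    (R : Matrix (Fin d) (Fin d) ℝ) (W : Matrix (Fin m) (Fin m) ℝ) (β : ℝ)
    (P : Matrix (Fin m) (Fin m) ℝ) : Matrix (Fin d) (Fin m) ℝ :=
  (R + Bᵀ * tildeP W β P * B)⁻¹ * (Bᵀ * tildeP W β P * A)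

/-- `P` is a fixed point of the modified Riccati equation. -/
def IsRiccatiFixedPoint {m d : ℕ} (A : Matrix (Fin m) (Fin m) ℝ) (B : Matrix (Fin m) (Fin d) ℝ)
    (Q : Matrix (Fin m) (Fin m) ℝ) (R : Matrix (Fin d) (Fin d) ℝ) (W : Matrix (Fin m) (Fin m) ℝ)
    (β : ℝ) (P : Matrix (Fin m) (Fin m) ℝ) : Prop :=
  P = Q + (riccatiGain A B R W β P)ᵀ * R * riccatiGain A B R W β P +
    (A - B * riccatiGain A B R W β P)ᵀ * tildeP W β P * (A - B * riccatiGain A B R W β P)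

/-- `P` is stabilizing: `ρ((A - B K)ᵀ (I - β P W)⁻¹) < 1` for the gain `K` that belongs to `P`,
where `ρ` is the spectral radius of the matrix over `ℂ`. -/
def IsStabilizing {m d : ℕ} (A : Matrix (Fin m) (Fin m) ℝ) (B : Matrix (Fin m) (Fin d) ℝ)
    (R : Matrix (Fin d) (Fin d) ℝ) (W : Matrix (Fin m) (Fin m) ℝ)
    (β : ℝ) (P : Matrix (Fin m) (Fin m) ℝ) : Prop :=
  spectralRadius ℂ
    (((A - B * riccatiGain A B R W β P)ᵀ * (1 - β • (P * W))⁻¹).map (algebraMap ℝ ℂ)) < 1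

/-- The value `-β⁻¹ log det (I - β P W)`. -/
def logDetValue {m : ℕ} (W : Matrix (Fin m) (Fin m) ℝ) (β : ℝ) (P : Matrix (Fin m) (Fin m) ℝ) :
    ℝ :=
  -β⁻¹ * Real.log (1 - β • (P * W)).det

end LEQG

end

/-! The engine is one step of dynamic programming in exponential form, `expMoment_succ`. If the
terminal cost is `xᵀ X x`, integrating out the last Gaussian disturbance replaces `X` by `P̃(X)` and
contributes the factor `det (I - β X W)^(-1/2)`. Completing the square in the last control then
leaves the terminal cost `f(X)`, with `f = riccatiMap`, plus a nonnegative penalty for deviating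
from the gain of `X`. All integrals take values in `[0, ∞]`, so neither a Markov property of the
policy nor integrability is needed.

Lower bound (`le_finiteHorizonCost`): starting from terminal weight `0` and dropping the penalties,
the `n`-stage cost is at least the average of `-β⁻¹ log det (I - β X_j W)` over the iterates `X_j =
f^j(0)`, `j < n`. For `β < 0` the inequality between moments reverses, and so does the sign of
`2/β`. By Cesàro, the average tends to `λ*` once `X_j → P` is known.

Upper bound (`finiteHorizonCost_linearFeedback_le`): with terminal weight `P` and the feedback of
`P` the penalty vanishes and `f(P) = P`, so the moment is exactly geometric in `n`. Removing the
terminal cost only lowers the objective, and the initial moment, finite since `X₀⁻¹ - βP > 0`, costs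
`O(1/n)`.

Convergence (`tendsto_riccatiIter`) is the delicate point. The iterates increase and stay below `P`,
hence converge to a fixed point `L ≤ P`. The difference `D = P - L` satisfies `D = C_Pᵀ D C_L` for
the two closed loops, but only `C_P` is known to be stable. Instead of iterating this identity, one
bounds `(ηᵀ D x)²` by a Lyapunov function of `C_P` at `η` times the gap `xᵀ (L - X_k) x`, by
induction on `k`. The gap tends to zero, so `D = 0`. -/

noncomputable section

namespace LEQG

/-! ### Quadratic forms. -/

/-- The quadratic form `xᵀ M x`. -/
def quad {n : ℕ} (M : Matrix (Fin n) (Fin n) ℝ) (x : Fin n → ℝ) : ℝ := x ⬝ᵥ (M *ᵥ x)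

lemma dotProduct_mulVec_comm {n : ℕ} {M : Matrix (Fin n) (Fin n) ℝ} (hM : Mᵀ = M)
    (x y : Fin n → ℝ) : x ⬝ᵥ (M *ᵥ y) = y ⬝ᵥ (M *ᵥ x) := by
  rw [Matrix.dotProduct_mulVec, ← Matrix.mulVec_transpose, hM, dotProduct_comm]

lemma quad_add {n : ℕ} {M : Matrix (Fin n) (Fin n) ℝ} (hM : Mᵀ = M) (x y : Fin n → ℝ) :
    quad M (x + y) = quad M x + 2 * (x ⬝ᵥ (M *ᵥ y)) + quad M y := by
  simp only [quad, Matrix.mulVec_add, dotProduct_add, add_dotProduct]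
  rw [dotProduct_mulVec_comm hM y x]; ring

lemma quad_sub {n : ℕ} {M : Matrix (Fin n) (Fin n) ℝ} (hM : Mᵀ = M) (x y : Fin n → ℝ) :
    quad M (x - y) = quad M x - 2 * (x ⬝ᵥ (M *ᵥ y)) + quad M y := by
  simp only [quad, Matrix.mulVec_sub, dotProduct_sub, sub_dotProduct]
  rw [dotProduct_mulVec_comm hM y x]; ring

lemma quad_neg {n : ℕ} (M : Matrix (Fin n) (Fin n) ℝ) (x : Fin n → ℝ) :
    quad M (-x) = quad M x := by
  simp [quad, Matrix.mulVec_neg]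

lemma quad_zero {n : ℕ} (M : Matrix (Fin n) (Fin n) ℝ) : quad M 0 = 0 := by simp [quad]

lemma quad_matrix_add {n : ℕ} (M N : Matrix (Fin n) (Fin n) ℝ) (x : Fin n → ℝ) :
    quad (M + N) x = quad M x + quad N x := by
  simp [quad, Matrix.add_mulVec, dotProduct_add]

lemma quad_matrix_sub {n : ℕ} (M N : Matrix (Fin n) (Fin n) ℝ) (x : Fin n → ℝ) :
    quad (M - N) x = quad M x - quad N x := by
  simp [quad, Matrix.sub_mulVec, dotProduct_sub]

lemma quad_matrix_smul {n : ℕ} (c : ℝ) (M : Matrix (Fin n) (Fin n) ℝ) (x : Fin n → ℝ) :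
    quad (c • M) x = c * quad M x := by
  simp [quad, Matrix.smul_mulVec, dotProduct_smul]

lemma quad_conj {n k : ℕ} (M : Matrix (Fin n) (Fin n) ℝ) (N : Matrix (Fin n) (Fin k) ℝ)
    (x : Fin k → ℝ) : quad (Nᵀ * M * N) x = quad M (N *ᵥ x) := by
  simp only [quad, ← Matrix.mulVec_mulVec]
  rw [Matrix.dotProduct_mulVec, Matrix.vecMul_transpose]

lemma posSemidef_iff_quad {n : ℕ} {M : Matrix (Fin n) (Fin n) ℝ} :
    M.PosSemidef ↔ Mᵀ = M ∧ ∀ x, 0 ≤ quad M x := by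
  rw [Matrix.posSemidef_iff_dotProduct_mulVec]
  simp [Matrix.IsHermitian, quad, Matrix.conjTranspose_eq_transpose_of_trivial]

lemma posDef_iff_quad {n : ℕ} {M : Matrix (Fin n) (Fin n) ℝ} :
    M.PosDef ↔ Mᵀ = M ∧ ∀ x, x ≠ 0 → 0 < quad M x := by
  rw [Matrix.posDef_iff_dotProduct_mulVec]
  simp [Matrix.IsHermitian, quad, Matrix.conjTranspose_eq_transpose_of_trivial]

lemma transpose_eq_of_posSemidef {n : ℕ} {M : Matrix (Fin n) (Fin n) ℝ} (h : M.PosSemidef) :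
    Mᵀ = M := (posSemidef_iff_quad.1 h).1

lemma transpose_eq_of_posDef {n : ℕ} {M : Matrix (Fin n) (Fin n) ℝ} (h : M.PosDef) :
    Mᵀ = M := transpose_eq_of_posSemidef h.posSemidef

lemma quad_nonneg {n : ℕ} {M : Matrix (Fin n) (Fin n) ℝ} (h : M.PosSemidef) (x : Fin n → ℝ) :
    0 ≤ quad M x := (posSemidef_iff_quad.1 h).2 x

lemma mul_inv_of_posDef {n : ℕ} {M : Matrix (Fin n) (Fin n) ℝ} (h : M.PosDef) : M * M⁻¹ = 1 :=
  Matrix.mul_nonsing_inv M ((Matrix.isUnit_iff_isUnit_det _).1 h.isUnit)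

/-! ### Algebra of the Riccati map: square completions and the difference identity. -/

/-- The Riccati map whose fixed points are the solutions of the modified Riccati equation. -/
def riccatiMap {m d : ℕ} (A : Matrix (Fin m) (Fin m) ℝ) (B : Matrix (Fin m) (Fin d) ℝ)
    (Q : Matrix (Fin m) (Fin m) ℝ) (R : Matrix (Fin d) (Fin d) ℝ) (W : Matrix (Fin m) (Fin m) ℝ)
    (β : ℝ) (X : Matrix (Fin m) (Fin m) ℝ) : Matrix (Fin m) (Fin m) ℝ :=
  Q + (riccatiGain A B R W β X)ᵀ * R * riccatiGain A B R W β X +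
    (A - B * riccatiGain A B R W β X)ᵀ * tildeP W β X * (A - B * riccatiGain A B R W β X)

/-- The extremal disturbance `w = β (W⁻¹ - β X)⁻¹ X y` at the predicted state `y`. -/
def extremalNoise {m : ℕ} (W : Matrix (Fin m) (Fin m) ℝ) (β : ℝ) (X : Matrix (Fin m) (Fin m) ℝ) :
    Matrix (Fin m) (Fin m) ℝ := β • ((W⁻¹ - β • X)⁻¹ * X)

/-- The closed loop under the optimal control and the extremal disturbance. -/
def closedLoop {m d : ℕ} (A : Matrix (Fin m) (Fin m) ℝ) (B : Matrix (Fin m) (Fin d) ℝ)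
    (R : Matrix (Fin d) (Fin d) ℝ) (W : Matrix (Fin m) (Fin m) ℝ)
    (β : ℝ) (X : Matrix (Fin m) (Fin m) ℝ) : Matrix (Fin m) (Fin m) ℝ :=
  (1 + extremalNoise W β X) * (A - B * riccatiGain A B R W β X)

/-- Matrices to which the Riccati map can be applied. -/
structure Admissible {m : ℕ} (W : Matrix (Fin m) (Fin m) ℝ) (β : ℝ)
    (X : Matrix (Fin m) (Fin m) ℝ) : Prop where
  posSemidef : X.PosSemidef
  posDef : (W⁻¹ - β • X).PosDef

section Algebra

variable {m d : ℕ} {A : Matrix (Fin m) (Fin m) ℝ} {B : Matrix (Fin m) (Fin d) ℝ}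
  {Q : Matrix (Fin m) (Fin m) ℝ} {R : Matrix (Fin d) (Fin d) ℝ} {W X Y P : Matrix (Fin m) (Fin m) ℝ}
  {β : ℝ}

lemma tildeP_eq : tildeP W β X = X * (1 + extremalNoise W β X) := by
  simp [tildeP, extremalNoise, mul_add, Matrix.mul_assoc]

lemma tildeP_transpose (hX : Admissible W β X) : (tildeP W β X)ᵀ = tildeP W β X := by
  have h1 := transpose_eq_of_posSemidef hX.posSemidef
  have h2 := transpose_eq_of_posDef hX.posDef.inv
  simp [tildeP, h1, h2, Matrix.mul_assoc]

/-- The left side is quadratic in `w` with leading part `-β⁻¹ (W⁻¹ - βX)` and stationary point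
`extremalNoise`. Thus `P̃` is a maximum over disturbances for `β > 0` and a minimum for `β < 0`. -/
lemma noise_square_completion (hβ : β ≠ 0) (hX : Admissible W β X) (y w : Fin m → ℝ) :
    quad X (y + w) - β⁻¹ * quad W⁻¹ w = quad (tildeP W β X) y -
      β⁻¹ * quad (W⁻¹ - β • X) (w - extremalNoise W β X *ᵥ y) := by
  have h1 := transpose_eq_of_posSemidef hX.posSemidef
  have h2 := transpose_eq_of_posDef hX.posDef
  have h3 : (W⁻¹ - β • X) *ᵥ (extremalNoise W β X *ᵥ y) = β • (X *ᵥ y) := by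
    rw [Matrix.mulVec_mulVec, extremalNoise, Matrix.mul_smul, ← Matrix.mul_assoc,
      mul_inv_of_posDef hX.posDef, Matrix.one_mul, Matrix.smul_mulVec]
  rw [quad_sub h2, h3, quad_add h1, tildeP_eq]
  have h4 : quad (W⁻¹ - β • X) (extremalNoise W β X *ᵥ y) =
      β * (extremalNoise W β X *ᵥ y ⬝ᵥ (X *ᵥ y)) := by
    rw [quad, h3, dotProduct_smul, smul_eq_mul]
  have h5 : quad (X * (1 + extremalNoise W β X)) y =
      quad X y + y ⬝ᵥ (X *ᵥ (extremalNoise W β X *ᵥ y)) := by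
    simp [quad, mul_add, Matrix.add_mulVec, dotProduct_add, Matrix.mulVec_mulVec]
  rw [h4, h5, quad_matrix_sub, quad_matrix_smul, dotProduct_smul, smul_eq_mul,
    dotProduct_mulVec_comm h1 y w, dotProduct_mulVec_comm h1 y]
  field_simp
  ring

lemma tildeP_posSemidef (hβ : β ≠ 0) (hW : W.PosDef) (hX : Admissible W β X) :
    (tildeP W β X).PosSemidef := by
  rw [posSemidef_iff_quad]
  refine ⟨tildeP_transpose hX, fun y => ?_⟩
  rcases lt_or_gt_of_ne hβ with hb | hb
  -- For `β < 0` the stationary value is a sum of two nonnegative terms.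
  · have h := noise_square_completion hβ hX y (extremalNoise W β X *ᵥ y)
    rw [sub_self, quad_zero, mul_zero, sub_zero] at h
    rw [← h]
    have h1 := quad_nonneg hX.posSemidef (y + extremalNoise W β X *ᵥ y)
    have h2 := quad_nonneg hW.inv.posSemidef (extremalNoise W β X *ᵥ y)
    have h3 := mul_nonneg (neg_nonneg.2 (inv_nonpos.2 hb.le)) h2
    linarith
  -- For `β > 0` the maximum dominates the value at zero disturbance, so `P̃ ≥ X ≥ 0`.
  · have h := noise_square_completion hβ hX y 0
    rw [add_zero, quad_zero, mul_zero, sub_zero] at h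
    have h1 := quad_nonneg hX.posSemidef y
    have h2 := quad_nonneg hX.posDef.posSemidef (0 - extremalNoise W β X *ᵥ y)
    have h3 := mul_nonneg (inv_nonneg.2 hb.le) h2
    linarith

lemma gain_denominator_posDef (hβ : β ≠ 0) (hR : R.PosDef) (hW : W.PosDef)
    (hX : Admissible W β X) : (R + Bᵀ * tildeP W β X * B).PosDef :=
  hR.add_posSemidef ((tildeP_posSemidef hβ hW hX).conjTranspose_mul_mul_same B)

lemma denominator_mul_gain (hβ : β ≠ 0) (hR : R.PosDef) (hW : W.PosDef) (hX : Admissible W β X) :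
    (R + Bᵀ * tildeP W β X * B) * riccatiGain A B R W β X = Bᵀ * tildeP W β X * A := by
  rw [riccatiGain, ← Matrix.mul_assoc, mul_inv_of_posDef (gain_denominator_posDef hβ hR hW hX),
    Matrix.one_mul]

lemma quad_riccatiMap (x : Fin m → ℝ) : quad (riccatiMap A B Q R W β X) x =
    quad Q x + quad R (-(riccatiGain A B R W β X *ᵥ x)) +
      quad (tildeP W β X) (A *ᵥ x + B *ᵥ (-(riccatiGain A B R W β X *ᵥ x))) := by
  rw [riccatiMap, quad_matrix_add, quad_matrix_add, quad_conj, quad_conj, quad_neg]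
  simp [Matrix.sub_mulVec, Matrix.mulVec_neg, ← sub_eq_add_neg]

/-- The control `-Kx` minimizes the left side, with minimum `f(X)`. Both values are expanded around
the same linear term, which `denominator_mul_gain` identifies. -/
lemma control_square_completion (hβ : β ≠ 0) (hR : R.PosDef) (hW : W.PosDef)
    (hX : Admissible W β X) (x : Fin m → ℝ) (u : Fin d → ℝ) :
    quad Q x + quad R u + quad (tildeP W β X) (A *ᵥ x + B *ᵥ u) =
      quad (riccatiMap A B Q R W β X) x +
        quad (R + Bᵀ * tildeP W β X * B) (u + riccatiGain A B R W β X *ᵥ x) := by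
  have hT := tildeP_transpose hX
  have hG := transpose_eq_of_posDef (gain_denominator_posDef (B := B) hβ hR hW hX)
  have hGk : (R + Bᵀ * tildeP W β X * B) *ᵥ (riccatiGain A B R W β X *ᵥ x) =
      Bᵀ *ᵥ (tildeP W β X *ᵥ (A *ᵥ x)) := by
    rw [Matrix.mulVec_mulVec, denominator_mul_gain hβ hR hW hX]
    simp [Matrix.mulVec_mulVec, Matrix.mul_assoc]
  have key : ∀ v : Fin d → ℝ, quad R v + quad (tildeP W β X) (A *ᵥ x + B *ᵥ v) =
      quad (R + Bᵀ * tildeP W β X * B) v +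
        2 * (v ⬝ᵥ (Bᵀ *ᵥ (tildeP W β X *ᵥ (A *ᵥ x)))) + quad (tildeP W β X) (A *ᵥ x) := by
    intro v
    rw [quad_add hT, quad_matrix_add, quad_conj, dotProduct_mulVec_comm hT (A *ᵥ x),
      Matrix.dotProduct_mulVec v, Matrix.vecMul_transpose]
    ring
  have h1 := key u
  have h2 := key (-(riccatiGain A B R W β X *ᵥ x))
  rw [quad_riccatiMap, quad_add hG]
  rw [← hGk] at h1 h2
  rw [quad_neg (R + Bᵀ * tildeP W β X * B), neg_dotProduct] at h2
  have h3 : (riccatiGain A B R W β X *ᵥ x) ⬝ᵥ ((R + Bᵀ * tildeP W β X * B) *ᵥ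
    (riccatiGain A B R W β X *ᵥ x)) = quad (R + Bᵀ * tildeP W β X * B)
    (riccatiGain A B R W β X *ᵥ x) := rfl
  linarith

lemma tildeP_mul_eq : tildeP W β X * (A - B * riccatiGain A B R W β X) =
    X * closedLoop A B R W β X := by
  rw [tildeP_eq, closedLoop, Matrix.mul_assoc]

/-- First-order optimality of the control, with `X * closedLoop` in the role of the costate. -/
lemma control_weight_mul_gain (hβ : β ≠ 0) (hR : R.PosDef) (hW : W.PosDef)
    (hX : Admissible W β X) :
    R * riccatiGain A B R W β X = Bᵀ * (X * closedLoop A B R W β X) := by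
  rw [← tildeP_mul_eq, Matrix.mul_sub, Matrix.mul_sub, ← Matrix.mul_assoc,
    ← denominator_mul_gain hβ hR hW hX, Matrix.add_mul]
  simp only [Matrix.mul_assoc]
  abel

lemma riccatiMap_eq (hβ : β ≠ 0) (hR : R.PosDef) (hW : W.PosDef) (hX : Admissible W β X) :
    riccatiMap A B Q R W β X = Q + Aᵀ * (X * closedLoop A B R W β X) := by
  rw [riccatiMap, Matrix.mul_assoc _ R, Matrix.mul_assoc _ (tildeP W β X), tildeP_mul_eq,
    control_weight_mul_gain hβ hR hW hX, Matrix.transpose_sub, Matrix.transpose_mul, Matrix.sub_mul]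
  simp only [Matrix.mul_assoc]
  abel

/-- First-order optimality of the disturbance: it equals `β W X` applied to the next state. -/
lemma closedLoop_eq (hW : W.PosDef) (hX : Admissible W β X) :
    closedLoop A B R W β X = A - B * riccatiGain A B R W β X +
      β • (W * (X * closedLoop A B R W β X)) := by
  have h : extremalNoise W β X = β • (W * (X * (1 + extremalNoise W β X))) := by
    have h1 : W⁻¹ * extremalNoise W β X = β • (X * (1 + extremalNoise W β X)) := by
      have : W⁻¹ = (W⁻¹ - β • X) + β • X := by abel
      rw [this, add_mul]
      have h2 : (W⁻¹ - β • X) * extremalNoise W β X = β • X := by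
        rw [extremalNoise, Matrix.mul_smul, ← Matrix.mul_assoc, mul_inv_of_posDef hX.posDef,
          Matrix.one_mul]
      rw [h2, mul_add, Matrix.mul_one, smul_add, Matrix.smul_mul]
    rw [← Matrix.mul_smul, ← h1, ← Matrix.mul_assoc, mul_inv_of_posDef hW, Matrix.one_mul]
  have h3 : closedLoop A B R W β X = (A - B * riccatiGain A B R W β X) +
      extremalNoise W β X * (A - B * riccatiGain A B R W β X) := by
    rw [closedLoop, add_mul, Matrix.one_mul]
  rw [h3]
  conv_lhs => rw [h]
  rw [← h3]
  simp [closedLoop, Matrix.mul_assoc]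

lemma riccatiMap_transpose (hQ : Q.PosDef) (hR : R.PosDef) (hX : Admissible W β X) :
    (riccatiMap A B Q R W β X)ᵀ = riccatiMap A B Q R W β X := by
  simp [riccatiMap, transpose_eq_of_posDef hQ, transpose_eq_of_posDef hR, tildeP_transpose hX,
    Matrix.mul_assoc]

/-- Write `f(X) = Q + C_Xᵀ X A` and `f(Y) = Q + Aᵀ Y C_Y`, and eliminate `A` on the right by the
closed loop of `Y`, `Aᵀ` on the left by that of `X`. The optimality conditions make the cross terms
in `R` and in `W` coincide, and they cancel. -/
lemma riccatiMap_sub (hβ : β ≠ 0) (hQ : Q.PosDef) (hR : R.PosDef) (hW : W.PosDef)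
    (hX : Admissible W β X) (hY : Admissible W β Y) :
    riccatiMap A B Q R W β X - riccatiMap A B Q R W β Y =
      (closedLoop A B R W β X)ᵀ * (X - Y) * closedLoop A B R W β Y := by
  have hXt := transpose_eq_of_posSemidef hX.posSemidef
  have hYt := transpose_eq_of_posSemidef hY.posSemidef
  have hRt := transpose_eq_of_posDef hR
  have hWt := transpose_eq_of_posDef hW
  set CX := closedLoop A B R W β X with hCX
  set CY := closedLoop A B R W β Y with hCY
  have e1 : riccatiMap A B Q R W β X = Q + CXᵀ * X * A := by
    rw [← riccatiMap_transpose hQ hR hX, riccatiMap_eq hβ hR hW hX]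
    simp [transpose_eq_of_posDef hQ, hXt, hCX]
  have e2 : riccatiMap A B Q R W β Y = Q + Aᵀ * (Y * CY) := riccatiMap_eq hβ hR hW hY
  have a1 : A = CY + B * riccatiGain A B R W β Y - β • (W * (Y * CY)) := by
    have := closedLoop_eq (A := A) (B := B) (R := R) hW hY
    rw [← hCY] at this
    revert this
    generalize β • (W * (Y * CY)) = T
    intro h
    rw [h]
    abel
  have a2 : Aᵀ = CXᵀ + (riccatiGain A B R W β X)ᵀ * Bᵀ - β • (CXᵀ * X * W) := by
    have := closedLoop_eq (A := A) (B := B) (R := R) hW hX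
    rw [← hCX] at this
    have h2 : A = CX + B * riccatiGain A B R W β X - β • (W * (X * CX)) := by
      revert this
      generalize β • (W * (X * CX)) = T
      intro h
      rw [h]
      abel
    conv_lhs => rw [h2]
    simp [Matrix.transpose_mul, hWt, hXt]
  have g1 : CXᵀ * X * B = (riccatiGain A B R W β X)ᵀ * R := by
    have := congrArg Matrix.transpose (control_weight_mul_gain (A := A) (B := B) hβ hR hW hX)
    rw [← hCX] at this
    simpa [Matrix.transpose_mul, hXt, hRt, eq_comm] using this
  have g2 : Bᵀ * (Y * CY) = R * riccatiGain A B R W β Y :=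
    (control_weight_mul_gain (A := A) (B := B) hβ hR hW hY).symm
  have f1 : CXᵀ * X * A = CXᵀ * X * CY + (riccatiGain A B R W β X)ᵀ * R * riccatiGain A B R W β Y -
      β • (CXᵀ * X * W * (Y * CY)) := by
    conv_lhs => rw [a1]
    rw [Matrix.mul_sub, Matrix.mul_add, ← Matrix.mul_assoc _ B, g1]
    simp [Matrix.mul_assoc]
  have f2 : Aᵀ * (Y * CY) = CXᵀ * (Y * CY) +
      (riccatiGain A B R W β X)ᵀ * R * riccatiGain A B R W β Y -
      β • (CXᵀ * X * W * (Y * CY)) := by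
    conv_lhs => rw [a2]
    rw [Matrix.sub_mul, Matrix.add_mul, Matrix.mul_assoc _ Bᵀ, g2]
    simp [Matrix.mul_assoc]
  rw [e1, e2, f1, f2]
  noncomm_ring

/-- Translates the stabilizing hypothesis into stability of the closed loop under the extremal
disturbance. -/
lemma transpose_closedLoop (hW : W.PosDef) (hX : Admissible W β X) :
    (closedLoop A B R W β X)ᵀ =
      (A - B * riccatiGain A B R W β X)ᵀ * (1 - β • (X * W))⁻¹ := by
  have hXt := transpose_eq_of_posSemidef hX.posSemidef
  have hHt := transpose_eq_of_posDef hX.posDef.inv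
  rw [closedLoop, Matrix.transpose_mul]
  congr 1
  symm
  apply Matrix.inv_eq_right_inv
  have h1 : W⁻¹ * (W⁻¹ - β • X)⁻¹ = 1 + β • (X * (W⁻¹ - β • X)⁻¹) := by
    have : W⁻¹ = (W⁻¹ - β • X) + β • X := by abel
    nth_rewrite 1 [this]
    rw [add_mul, mul_inv_of_posDef hX.posDef, Matrix.smul_mul]
  have h2 : (1 + extremalNoise W β X)ᵀ = W⁻¹ * (W⁻¹ - β • X)⁻¹ := by
    rw [h1]
    simp [extremalNoise, hXt, hHt]
  have h3 : (1 - β • (X * W)) * W⁻¹ = W⁻¹ - β • X := by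
    rw [sub_mul, Matrix.one_mul, Matrix.smul_mul, Matrix.mul_assoc, mul_inv_of_posDef hW,
      Matrix.mul_one]
  rw [h2, ← Matrix.mul_assoc, h3, mul_inv_of_posDef hX.posDef]

end Algebra

/-! ### Weighted Cauchy–Schwarz inequalities. -/

/-- The polynomial `t ↦ quad H (e - t H⁻¹ a)` is nonnegative, so its discriminant is not positive.
-/
lemma sq_dotProduct_le {n : ℕ} {H : Matrix (Fin n) (Fin n) ℝ} (hH : H.PosDef)
    (a e : Fin n → ℝ) : (a ⬝ᵥ e) ^ 2 ≤ quad H⁻¹ a * quad H e := by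
  have h1 : ∀ t : ℝ, 0 ≤ quad H⁻¹ a * (t * t) + (-2 * (a ⬝ᵥ e)) * t + quad H e := by
    intro t
    have h2 := quad_nonneg hH.posSemidef (e - t • (H⁻¹ *ᵥ a))
    have h3 : H *ᵥ (t • (H⁻¹ *ᵥ a)) = t • a := by
      rw [Matrix.mulVec_smul, Matrix.mulVec_mulVec, mul_inv_of_posDef hH, Matrix.one_mulVec]
    have h4 : quad H (t • (H⁻¹ *ᵥ a)) = t * t * quad H⁻¹ a := by
      rw [quad, h3, quad, smul_dotProduct, dotProduct_smul, dotProduct_comm]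
      simp; ring
    rw [quad_sub (transpose_eq_of_posDef hH), h3, h4, dotProduct_smul, dotProduct_comm e a,
      smul_eq_mul] at h2
    linarith
  have := discrim_le_zero h1
  rw [discrim] at this
  linarith

/-- The cross term is controlled by `(2αγ)² ≤ 4abcd ≤ (ad + cb)²`. This combines two Cauchy–Schwarz
bounds in the inductive step of the convergence proof. -/
lemma sq_sub_le_of_sq_le {a b c d α γ : ℝ} (ha : 0 ≤ a) (hb : 0 ≤ b) (hc : 0 ≤ c) (hd : 0 ≤ d)
    (hα : α ^ 2 ≤ a * b) (hγ : γ ^ 2 ≤ c * d) : (α - γ) ^ 2 ≤ (a + c) * (b + d) := by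
  have h1 : (2 * α * γ) ^ 2 ≤ (a * d + c * b) ^ 2 := by
    have h2 : α ^ 2 * γ ^ 2 ≤ a * b * (c * d) :=
      mul_le_mul hα hγ (sq_nonneg _) (mul_nonneg ha hb)
    nlinarith [sq_nonneg (a * d - c * b)]
  have h3 := neg_le_of_abs_le (abs_le_of_sq_le_sq h1 (by positivity))
  linarith

/-! ### Monotonicity and continuity of the Riccati map. -/

section Key

variable {m d : ℕ} {A : Matrix (Fin m) (Fin m) ℝ} {B : Matrix (Fin m) (Fin d) ℝ}
  {Q : Matrix (Fin m) (Fin m) ℝ} {R : Matrix (Fin d) (Fin d) ℝ} {W X Y P : Matrix (Fin m) (Fin m) ℝ}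
  {β : ℝ}

lemma Admissible.of_le (hβ : β ≠ 0) (hW : W.PosDef) (hP : Admissible W β P)
    (hX : X.PosSemidef) (hXP : ∀ x, quad X x ≤ quad P x) : Admissible W β X := by
  refine ⟨hX, posDef_iff_quad.2 ⟨?_, fun x hx => ?_⟩⟩
  · simp [transpose_eq_of_posDef hW.inv, transpose_eq_of_posSemidef hX]
  · rw [quad_matrix_sub, quad_matrix_smul]
    rcases lt_or_gt_of_ne hβ with hb | hb
    · have h1 := (posDef_iff_quad.1 hW.inv).2 x hx
      have h2 := mul_nonneg (neg_nonneg.2 hb.le) (quad_nonneg hX x)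
      linarith
    · have h1 := (posDef_iff_quad.1 hP.posDef).2 x hx
      rw [quad_matrix_sub, quad_matrix_smul] at h1
      have h2 := mul_le_mul_of_nonneg_left (hXP x) hb.le
      linarith

lemma admissible_zero (hW : W.PosDef) : Admissible W β 0 :=
  ⟨Matrix.PosSemidef.zero, by simpa using hW.inv⟩

/-- Compare the two game values along one control, optimal for `Y` and suboptimal for `X`, and one
disturbance, optimal for the side where this helps. Beyond monotonicity, it keeps the term in `e`,
the deviation from the closed loop of `Y`, which the convergence proof needs. -/
lemma exists_quad_riccatiMap_sub_ge (hβ : β ≠ 0) (hR : R.PosDef) (hW : W.PosDef)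
    (hX : Admissible W β X) (hY : Admissible W β Y) (x : Fin m → ℝ) :
    ∃ e, |β⁻¹| * quad (W⁻¹ - β • Y) e + (quad Y (closedLoop A B R W β Y *ᵥ x + e) -
      quad X (closedLoop A B R W β Y *ᵥ x + e)) ≤
      quad (riccatiMap A B Q R W β Y) x - quad (riccatiMap A B Q R W β X) x := by
  set u := -(riccatiGain A B R W β Y *ᵥ x) with hu
  set y := A *ᵥ x + B *ᵥ u with hy
  have hcl : closedLoop A B R W β Y *ᵥ x = y + extremalNoise W β Y *ᵥ y := by
    have : y = (A - B * riccatiGain A B R W β Y) *ᵥ x := by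
      rw [hy, hu, Matrix.sub_mulVec, Matrix.mulVec_neg, Matrix.mulVec_mulVec, sub_eq_add_neg]
    rw [closedLoop, ← Matrix.mulVec_mulVec, ← this, Matrix.add_mulVec, Matrix.one_mulVec]
  have hfY : quad (riccatiMap A B Q R W β Y) x = quad Q x + quad R u + quad (tildeP W β Y) y :=
    quad_riccatiMap x
  have hfX : quad (riccatiMap A B Q R W β X) x ≤ quad Q x + quad R u + quad (tildeP W β X) y := by
    rw [control_square_completion hβ hR hW hX]
    have := quad_nonneg (gain_denominator_posDef (B := B) hβ hR hW hX).posSemidef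
      (u + riccatiGain A B R W β X *ᵥ x)
    linarith
  rcases lt_or_gt_of_ne hβ with hb | hb
  -- For `β < 0` the disturbance minimizes: the one extremal for `Y` bounds the value of `X` from
  -- above, with no deviation.
  · refine ⟨0, ?_⟩
    have h1 := noise_square_completion hβ hY y (extremalNoise W β Y *ᵥ y)
    have h2 := noise_square_completion hβ hX y (extremalNoise W β Y *ᵥ y)
    rw [sub_self, quad_zero, mul_zero] at h1
    have h3 := mul_nonneg (neg_nonneg.2 (inv_nonpos.2 hb.le))
      (quad_nonneg hX.posDef.posSemidef (extremalNoise W β Y *ᵥ y - extremalNoise W β X *ᵥ y))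
    rw [quad_zero, mul_zero, add_zero, hcl]
    linarith
  -- For `β > 0` the disturbance maximizes: the one extremal for `X` is used, and its loss in the
  -- problem of `Y` is the term in `e`.
  · refine ⟨extremalNoise W β X *ᵥ y - extremalNoise W β Y *ᵥ y, ?_⟩
    have h1 := noise_square_completion hβ hY y (extremalNoise W β X *ᵥ y)
    have h2 := noise_square_completion hβ hX y (extremalNoise W β X *ᵥ y)
    rw [sub_self, quad_zero, mul_zero] at h2
    have h3 : y + extremalNoise W β Y *ᵥ y + (extremalNoise W β X *ᵥ y - extremalNoise W β Y *ᵥ y)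
      = y + extremalNoise W β X *ᵥ y := by abel
    rw [abs_of_pos (inv_pos.2 hb), hcl, h3]
    linarith

lemma riccatiMap_mono (hβ : β ≠ 0) (hR : R.PosDef) (hW : W.PosDef)
    (hX : Admissible W β X) (hY : Admissible W β Y) (h : ∀ x, quad X x ≤ quad Y x)
    (x : Fin m → ℝ) :
    quad (riccatiMap A B Q R W β X) x ≤ quad (riccatiMap A B Q R W β Y) x := by
  obtain ⟨e, he⟩ := exists_quad_riccatiMap_sub_ge (A := A) (B := B) (Q := Q) hβ hR hW hX hY x
  have h1 := mul_nonneg (abs_nonneg β⁻¹) (quad_nonneg hY.posDef.posSemidef e)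
  linarith [h (closedLoop A B R W β Y *ᵥ x + e)]

lemma riccatiMap_posSemidef (hβ : β ≠ 0) (hQ : Q.PosDef) (hR : R.PosDef) (hW : W.PosDef)
    (hX : Admissible W β X) : (riccatiMap A B Q R W β X).PosSemidef :=
  (hQ.posSemidef.add (hR.posSemidef.conjTranspose_mul_mul_same _)).add
    ((tildeP_posSemidef hβ hW hX).conjTranspose_mul_mul_same _)

lemma quad_le_quad_riccatiMap (hβ : β ≠ 0) (hR : R.PosDef) (hW : W.PosDef)
    (hX : Admissible W β X) (x : Fin m → ℝ) :
    quad Q x ≤ quad (riccatiMap A B Q R W β X) x := by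
  rw [riccatiMap, quad_matrix_add, quad_matrix_add, quad_conj, quad_conj]
  have h1 := quad_nonneg hR.posSemidef (riccatiGain A B R W β X *ᵥ x)
  have h2 := quad_nonneg (tildeP_posSemidef hβ hW hX)
    ((A - B * riccatiGain A B R W β X) *ᵥ x)
  linarith

lemma continuousAt_inv_of_posDef {n : ℕ} {M : Matrix (Fin n) (Fin n) ℝ} (hM : M.PosDef) :
    ContinuousAt Inv.inv M := by
  apply continuousAt_matrix_inv
  rw [Ring.inverse_eq_inv']
  exact continuousAt_inv₀ hM.det_pos.ne'

lemma continuousAt_tildeP (hX : Admissible W β X) : ContinuousAt (tildeP W β) X := by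
  have h : ContinuousAt (fun X : Matrix (Fin m) (Fin m) ℝ => (W⁻¹ - β • X)⁻¹) X :=
    ContinuousAt.comp (g := Inv.inv) (continuousAt_inv_of_posDef hX.posDef)
      (by fun_prop : Continuous fun X : Matrix (Fin m) (Fin m) ℝ => W⁻¹ - β • X).continuousAt
  unfold tildeP
  exact continuousAt_id.add (((continuousAt_id.mul h).mul continuousAt_id).const_smul β)

lemma continuousAt_matrix_mul {k l n : ℕ} {Z : Type*} [TopologicalSpace Z] {z : Z}
    {F : Z → Matrix (Fin k) (Fin l) ℝ} {G : Z → Matrix (Fin l) (Fin n) ℝ}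
    (hF : ContinuousAt F z) (hG : ContinuousAt G z) : ContinuousAt (fun z => F z * G z) z := by
  have h : Continuous fun p : Matrix (Fin k) (Fin l) ℝ × Matrix (Fin l) (Fin n) ℝ =>
    p.1 * p.2 := by fun_prop
  exact ContinuousAt.comp (f := fun z => (F z, G z)) h.continuousAt (hF.prodMk hG)

lemma continuousAt_matrix_transpose {k l : ℕ} {Z : Type*} [TopologicalSpace Z] {z : Z}
    {F : Z → Matrix (Fin k) (Fin l) ℝ} (hF : ContinuousAt F z) :
    ContinuousAt (fun z => (F z)ᵀ) z :=
  ContinuousAt.comp (f := F) (continuous_id.matrix_transpose.continuousAt) hF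

lemma continuousAt_riccatiGain (hβ : β ≠ 0) (hR : R.PosDef) (hW : W.PosDef)
    (hX : Admissible W β X) : ContinuousAt (riccatiGain A B R W β) X := by
  have ht := continuousAt_tildeP hX
  have h1 : ContinuousAt (fun X => Bᵀ * tildeP W β X) X :=
    continuousAt_matrix_mul continuousAt_const ht
  refine continuousAt_matrix_mul ?_ (continuousAt_matrix_mul h1 continuousAt_const)
  exact ContinuousAt.comp (g := Inv.inv) (f := fun X => R + Bᵀ * tildeP W β X * B)
    (continuousAt_inv_of_posDef (gain_denominator_posDef hβ hR hW hX))
    (continuousAt_const.add (continuousAt_matrix_mul h1 continuousAt_const))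

lemma continuousAt_riccatiMap (hβ : β ≠ 0) (hR : R.PosDef) (hW : W.PosDef)
    (hX : Admissible W β X) : ContinuousAt (riccatiMap A B Q R W β) X := by
  have ht := continuousAt_tildeP hX
  have hK : ContinuousAt (riccatiGain A B R W β) X := continuousAt_riccatiGain hβ hR hW hX
  have hK' : ContinuousAt (fun X => A - B * riccatiGain A B R W β X) X :=
    continuousAt_const.sub (continuousAt_matrix_mul continuousAt_const hK)
  have h1 := continuousAt_matrix_mul (continuousAt_matrix_mul
    (continuousAt_matrix_transpose hK) (continuousAt_const (y := R))) hK
  have h2 := continuousAt_matrix_mul (continuousAt_matrix_mul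
    (continuousAt_matrix_transpose hK') ht) hK'
  exact (continuousAt_const.add h1).add h2

end Key

/-! ### Geometric decay of powers and Lyapunov functions. -/

section Spectral

attribute [local instance] Matrix.linftyOpNormedRing Matrix.linftyOpNormedAlgebra

/-- Gelfand's formula over `ℂ`, for the operator norm induced by the sup norm, which dominates every
entry. -/
lemma exists_geometric_bound_of_spectralRadius_lt_one {m : ℕ} (M : Matrix (Fin m) (Fin m) ℝ)
    (h : spectralRadius ℂ (M.map (algebraMap ℝ ℂ)) < 1) :
    ∃ r : ℝ, 0 ≤ r ∧ r < 1 ∧ ∀ᶠ t : ℕ in atTop, ∀ i j, |(M ^ t) i j| ≤ r ^ t := by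
  set N := M.map (algebraMap ℝ ℂ) with hN
  obtain ⟨r, hr1, hr2⟩ := ENNReal.lt_iff_exists_nnreal_btwn.1 h
  have : CompleteSpace (Matrix (Fin m) (Fin m) ℂ) := FiniteDimensional.complete ℂ _
  have hG := spectrum.pow_nnnorm_pow_one_div_tendsto_nhds_spectralRadius N
  refine ⟨r, r.2, by exact_mod_cast hr2, ?_⟩
  filter_upwards [hG.eventually (gt_mem_nhds hr1), eventually_ge_atTop 1] with t ht ht1 i j
  have h1 : (‖N ^ t‖₊ : ENNReal) ≤ (r : ENNReal) ^ t := by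
    have h2 := ENNReal.rpow_le_rpow ht.le (Nat.cast_nonneg t : (0 : ℝ) ≤ t)
    rw [← ENNReal.rpow_mul, one_div, inv_mul_cancel₀ (by positivity), ENNReal.rpow_one,
      ENNReal.rpow_natCast] at h2
    exact h2
  have h3 : ‖N ^ t‖ ≤ (r : ℝ) ^ t := by exact_mod_cast h1
  have h4 : N ^ t = (M ^ t).map (algebraMap ℝ ℂ) := by
    rw [hN]; exact (map_pow (algebraMap ℝ ℂ).mapMatrix M t).symm
  have h5 := Matrix.linfty_opNorm_mulVec (N ^ t) (Pi.single j (1 : ℂ))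
  have h6 := norm_le_pi_norm ((N ^ t) *ᵥ Pi.single j (1 : ℂ)) i
  rw [Pi.norm_single, norm_one, mul_one] at h5
  have h7 : ‖((N ^ t) *ᵥ Pi.single j (1 : ℂ)) i‖ = |(M ^ t) i j| := by
    rw [Matrix.mulVec_single_one, Matrix.col_apply, h4, Matrix.map_apply]; simp
  rw [h7] at h6
  exact h6.trans (h5.trans h3)

end Spectral

/-- Take `θ η = ∑ₜ quad Ψ ((Mᵀ)^t η)`; its terms are `O(r^(2t))` with `r < 1`. -/
lemma exists_lyapunov_function {m : ℕ} (M : Matrix (Fin m) (Fin m) ℝ)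
    (h : spectralRadius ℂ (M.map (algebraMap ℝ ℂ)) < 1) {Ψ : Matrix (Fin m) (Fin m) ℝ}
    (hΨ : Ψ.PosSemidef) : ∃ θ : (Fin m → ℝ) → ℝ, (∀ η, 0 ≤ θ η) ∧
      ∀ η, θ η = quad Ψ η + θ (Mᵀ *ᵥ η) := by
  obtain ⟨r, hr0, hr1, hr⟩ := exists_geometric_bound_of_spectralRadius_lt_one M h
  have hsum : ∀ η : Fin m → ℝ, Summable fun t : ℕ => quad Ψ ((Mᵀ) ^ t *ᵥ η) := by
    intro η
    have hO : ∀ i, (fun t : ℕ => ((Mᵀ) ^ t *ᵥ η) i) =O[atTop] fun t => r ^ t := by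
      intro i
      simp only [Matrix.mulVec, dotProduct]
      refine Asymptotics.IsBigO.fun_sum fun j _ => ?_
      simp_rw [mul_comm _ (η j)]
      refine Asymptotics.IsBigO.const_mul_left ?_ _
      refine Asymptotics.IsBigO.of_bound 1 ?_
      filter_upwards [hr] with t ht
      rw [← Matrix.transpose_pow, Matrix.transpose_apply, Real.norm_eq_abs, Real.norm_eq_abs,
        abs_of_nonneg (pow_nonneg hr0 t), one_mul]
      exact ht j i
    refine summable_of_isBigO_nat (g := fun t => (r * r) ^ t)
      (summable_geometric_of_lt_one (by positivity) (by nlinarith)) ?_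
    simp only [mul_pow, quad, dotProduct]
    refine Asymptotics.IsBigO.fun_sum fun i _ => (hO i).mul ?_
    change (fun t : ℕ => ∑ j, Ψ i j * ((Mᵀ) ^ t *ᵥ η) j) =O[atTop] _
    exact Asymptotics.IsBigO.fun_sum fun j _ => (hO j).const_mul_left _
  refine ⟨fun η => ∑' t : ℕ, quad Ψ ((Mᵀ) ^ t *ᵥ η),
    fun η => tsum_nonneg fun t => quad_nonneg hΨ _, fun η => ?_⟩
  beta_reduce
  rw [(hsum η).tsum_eq_zero_add]
  simp [pow_succ, Matrix.mulVec_mulVec]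

/-! ### Limits of monotone sequences of quadratic forms. -/

lemma tendsto_quad {ι : Type*} {l : Filter ι} {n : ℕ} {F : ι → Matrix (Fin n) (Fin n) ℝ}
    {L : Matrix (Fin n) (Fin n) ℝ} (h : Tendsto F l (𝓝 L)) (x : Fin n → ℝ) :
    Tendsto (fun k => quad (F k) x) l (𝓝 (quad L x)) := by
  have : Continuous fun M : Matrix (Fin n) (Fin n) ℝ => quad M x := by
    unfold quad; fun_prop
  exact (this.tendsto L).comp h

lemma entry_eq_quad {n : ℕ} {M : Matrix (Fin n) (Fin n) ℝ} (hM : Mᵀ = M) (i j : Fin n) :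
    M i j = (quad M (Pi.single i 1 + Pi.single j 1) - quad M (Pi.single i 1) -
      quad M (Pi.single j 1)) / 2 := by
  rw [quad_add hM]
  simp only [Matrix.mulVec_single_one, single_one_dotProduct, Matrix.col_apply]
  ring

lemma eq_of_quad_eq {n : ℕ} {M N : Matrix (Fin n) (Fin n) ℝ} (hM : Mᵀ = M) (hN : Nᵀ = N)
    (h : ∀ x, quad M x = quad N x) : M = N := by
  ext i j
  rw [entry_eq_quad hM, entry_eq_quad hN, h, h, h]

/-- Each quadratic form converges as a bounded monotone sequence, and polarization recovers the
entries. -/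
lemma exists_tendsto_of_monotone_quad {n : ℕ} {F : ℕ → Matrix (Fin n) (Fin n) ℝ}
    {P : Matrix (Fin n) (Fin n) ℝ} (hF : ∀ k, (F k)ᵀ = F k)
    (hmono : ∀ x, Monotone fun k => quad (F k) x) (hle : ∀ k x, quad (F k) x ≤ quad P x) :
    ∃ L, Tendsto F atTop (𝓝 L) := by
  have hc : ∀ x, ∃ l, Tendsto (fun k => quad (F k) x) atTop (𝓝 l) := fun x =>
    ⟨_, tendsto_atTop_ciSup (hmono x) ⟨quad P x, by rintro _ ⟨k, rfl⟩; exact hle k x⟩⟩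
  choose g hg using hc
  refine ⟨Matrix.of fun i j => (g (Pi.single i 1 + Pi.single j 1) - g (Pi.single i 1) -
      g (Pi.single j 1)) / 2, ?_⟩
  refine tendsto_pi_nhds.2 fun i => tendsto_pi_nhds.2 fun j => ?_
  simp_rw [fun k => entry_eq_quad (hF k) i j]
  exact (((hg _).sub (hg _)).sub (hg _)).div_const 2

/-! ### Convergence of the Riccati iteration from zero. -/

section Convergence

variable {m d : ℕ} {A : Matrix (Fin m) (Fin m) ℝ} {B : Matrix (Fin m) (Fin d) ℝ}
  {Q : Matrix (Fin m) (Fin m) ℝ} {R : Matrix (Fin d) (Fin d) ℝ} {W P : Matrix (Fin m) (Fin m) ℝ}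
  {β : ℝ}

/-- The Riccati iteration started at zero. -/
def riccatiIter (A : Matrix (Fin m) (Fin m) ℝ) (B : Matrix (Fin m) (Fin d) ℝ)
    (Q : Matrix (Fin m) (Fin m) ℝ) (R : Matrix (Fin d) (Fin d) ℝ) (W : Matrix (Fin m) (Fin m) ℝ)
    (β : ℝ) : ℕ → Matrix (Fin m) (Fin m) ℝ
  | 0 => 0
  | k + 1 => riccatiMap A B Q R W β (riccatiIter A B Q R W β k)

lemma riccatiIter_admissible_and_le (hβ : β ≠ 0) (hQ : Q.PosDef) (hR : R.PosDef) (hW : W.PosDef)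
    (hP : Admissible W β P) (hfix : riccatiMap A B Q R W β P = P) (k : ℕ) :
    Admissible W β (riccatiIter A B Q R W β k) ∧
      ∀ x, quad (riccatiIter A B Q R W β k) x ≤ quad P x := by
  induction k with
  | zero =>
    refine ⟨admissible_zero hW, fun x => ?_⟩
    simpa [riccatiIter, quad] using quad_nonneg hP.posSemidef x
  | succ k ih =>
    have h : ∀ x, quad (riccatiIter A B Q R W β (k + 1)) x ≤ quad P x := fun x => by
      conv_rhs => rw [← hfix]
      exact riccatiMap_mono hβ hR hW ih.1 hP ih.2 x
    exact ⟨hP.of_le hβ hW (riccatiMap_posSemidef hβ hQ hR hW ih.1) h, h⟩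

lemma riccatiIter_monotone (hβ : β ≠ 0) (hQ : Q.PosDef) (hR : R.PosDef) (hW : W.PosDef)
    (hP : Admissible W β P) (hfix : riccatiMap A B Q R W β P = P) (x : Fin m → ℝ) :
    Monotone fun k => quad (riccatiIter A B Q R W β k) x := by
  have hadm := fun k => (riccatiIter_admissible_and_le hβ hQ hR hW hP hfix k).1
  refine monotone_nat_of_le_succ fun k => ?_
  induction k generalizing x with
  | zero =>
    simpa [riccatiIter, quad] using quad_nonneg (hadm 1).posSemidef x
  | succ k ih => exact riccatiMap_mono hβ hR hW (hadm k) (hadm (k + 1)) ih x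

/-- A stabilizing solution of the Riccati equation is the limit of the iteration from zero. -/
theorem tendsto_riccatiIter (hβ : β ≠ 0) (hQ : Q.PosDef) (hR : R.PosDef) (hW : W.PosDef)
    (hP : Admissible W β P) (hfix : riccatiMap A B Q R W β P = P)
    (hstab : IsStabilizing A B R W β P) :
    Tendsto (riccatiIter A B Q R W β) atTop (𝓝 P) := by
  have hadm := fun k => (riccatiIter_admissible_and_le hβ hQ hR hW hP hfix k).1
  have hle := fun k => (riccatiIter_admissible_and_le hβ hQ hR hW hP hfix k).2
  have hmono := riccatiIter_monotone hβ hQ hR hW hP hfix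
  have htr := fun k => transpose_eq_of_posSemidef (hadm k).posSemidef
  obtain ⟨L, hL⟩ := exists_tendsto_of_monotone_quad htr hmono hle
  have hLt : Lᵀ = L := by
    refine tendsto_nhds_unique ((continuous_id.matrix_transpose.tendsto L).comp hL) ?_
    simpa [Function.comp_def, htr] using hL
  have hkL : ∀ k x, quad (riccatiIter A B Q R W β k) x ≤ quad L x := fun k x =>
    (hmono x).ge_of_tendsto (tendsto_quad hL x) k
  have hLP : ∀ x, quad L x ≤ quad P x := fun x =>
    le_of_tendsto' (tendsto_quad hL x) fun k => hle k x
  -- `Q ≤ f(0) = X₁ ≤ L`. Positive definiteness, not only semidefiniteness, is needed because `L⁻¹`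
  -- enters the Lyapunov weight.
  have hLpos : L.PosDef := posDef_iff_quad.2 ⟨hLt, fun x hx =>
    ((posDef_iff_quad.1 hQ).2 x hx).trans_le
      ((quad_le_quad_riccatiMap hβ hR hW (hadm 0) x).trans (hkL 1 x))⟩
  have hLadm : Admissible W β L := hP.of_le hβ hW hLpos.posSemidef hLP
  have hfixL : riccatiMap A B Q R W β L = L := by
    refine tendsto_nhds_unique ((continuousAt_riccatiMap hβ hR hW hLadm).tendsto.comp hL) ?_
    exact (tendsto_add_atTop_iff_nat 1).2 hL
  set D := P - L with hD
  have hDt : Dᵀ = D := by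
    rw [hD, Matrix.transpose_sub, hLt, transpose_eq_of_posSemidef hP.posSemidef]
  have hDeq : D = (closedLoop A B R W β P)ᵀ * D * closedLoop A B R W β L := by
    conv_lhs => rw [hD, ← hfix, ← hfixL]
    exact riccatiMap_sub hβ hQ hR hW hP hLadm
  have hH := hLadm.posDef
  -- The weight has two parts: `Dᵀ L⁻¹ D` starts the induction below, and the part with `(W⁻¹ -
  -- βL)⁻¹` pays for the deviation `e` at each step.
  obtain ⟨θ, hθ0, hθ⟩ := exists_lyapunov_function (closedLoop A B R W β P)ᵀ
    (by rw [transpose_closedLoop hW hP]; exact hstab)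
    (Ψ := (|β| • ((D * closedLoop A B R W β P)ᵀ * (W⁻¹ - β • L)⁻¹ * (D * closedLoop A B R W β P))) +
      Dᵀ * L⁻¹ * D)
    (((hH.inv.posSemidef.conjTranspose_mul_mul_same _).smul (abs_nonneg β)).add
      (hLpos.inv.posSemidef.conjTranspose_mul_mul_same _))
  simp only [Matrix.transpose_transpose, quad_matrix_add, quad_matrix_smul, quad_conj,
    ← Matrix.mulVec_mulVec] at hθ
  -- Under `D = C_Pᵀ D C_L`, `η` moves along the stable loop `C_P`, while `x` moves along `C_L` up
  -- to `e`. The Lyapunov identity absorbs the first motion and the decrease of the gap `L - X_k`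
  -- the second, so no stability of `C_L` is used.
  have claim : ∀ k (η x : Fin m → ℝ), (η ⬝ᵥ (D *ᵥ x)) ^ 2 ≤
      θ η * (quad L x - quad (riccatiIter A B Q R W β k) x) := by
    intro k
    induction k with
    | zero =>
      intro η x
      have h0 : quad (riccatiIter A B Q R W β 0) x = 0 := by simp [riccatiIter, quad]
      rw [h0, sub_zero, dotProduct_mulVec_comm hDt, dotProduct_comm]
      refine (sq_dotProduct_le hLpos _ _).trans
        (mul_le_mul_of_nonneg_right ?_ (quad_nonneg hLpos.posSemidef x))
      have h1 := mul_nonneg (abs_nonneg β)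
        (quad_nonneg hH.inv.posSemidef (D *ᵥ (closedLoop A B R W β P *ᵥ η)))
      linarith [hθ η, hθ0 (closedLoop A B R W β P *ᵥ η)]
    | succ k ih =>
      intro η x
      obtain ⟨e, he⟩ := exists_quad_riccatiMap_sub_ge (A := A) (B := B) (Q := Q)
        hβ hR hW (hadm k) hLadm x
      rw [hfixL] at he
      set z := closedLoop A B R W β L *ᵥ x + e with hz
      set ξ := closedLoop A B R W β P *ᵥ η with hξ
      have h1 : η ⬝ᵥ (D *ᵥ x) = ξ ⬝ᵥ (D *ᵥ z) - ξ ⬝ᵥ (D *ᵥ e) := by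
        conv_lhs => rw [hDeq]
        rw [← dotProduct_sub, ← Matrix.mulVec_sub, hz, add_sub_cancel_right,
          ← Matrix.mulVec_mulVec, ← Matrix.mulVec_mulVec, Matrix.dotProduct_mulVec η,
          Matrix.vecMul_transpose]
      have h2 := ih ξ z
      have h3 : (ξ ⬝ᵥ (D *ᵥ e)) ^ 2 ≤ (|β| * quad (W⁻¹ - β • L)⁻¹ (D *ᵥ ξ)) *
          (|β⁻¹| * quad (W⁻¹ - β • L) e) := by
        rw [dotProduct_mulVec_comm hDt, dotProduct_comm]
        refine (sq_dotProduct_le hH _ _).trans (le_of_eq ?_)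
        rw [abs_inv]
        have := abs_pos.2 hβ
        field_simp
      have hn1 : 0 ≤ |β| * quad (W⁻¹ - β • L)⁻¹ (D *ᵥ ξ) :=
        mul_nonneg (abs_nonneg _) (quad_nonneg hH.inv.posSemidef _)
      have hn2 : 0 ≤ |β⁻¹| * quad (W⁻¹ - β • L) e :=
        mul_nonneg (abs_nonneg _) (quad_nonneg hH.posSemidef _)
      rw [h1]
      refine (sq_sub_le_of_sq_le (hθ0 ξ) (sub_nonneg.2 (hkL k z)) hn1 hn2 h2 h3).trans ?_
      refine mul_le_mul ?_ ?_ (add_nonneg (sub_nonneg.2 (hkL k z)) hn2) (hθ0 η)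
      · linarith [hθ η, quad_nonneg hLpos.inv.posSemidef (D *ᵥ η)]
      · simp only [riccatiIter]; linarith
  have hzero : ∀ η x : Fin m → ℝ, η ⬝ᵥ (D *ᵥ x) = 0 := by
    intro η x
    have h1 : Tendsto (fun k => θ η * (quad L x - quad (riccatiIter A B Q R W β k) x)) atTop
        (𝓝 (θ η * (quad L x - quad L x))) :=
      ((tendsto_quad hL x).const_sub _).const_mul _
    rw [sub_self, mul_zero] at h1
    exact pow_eq_zero_iff two_ne_zero |>.1
      (le_antisymm (ge_of_tendsto' h1 fun k => claim k η x) (sq_nonneg _))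
  have hPL : P = L := by
    refine eq_of_quad_eq (transpose_eq_of_posSemidef hP.posSemidef) hLt fun x => ?_
    have := hzero x x
    change quad D x = 0 at this
    rw [hD, quad_matrix_sub] at this
    linarith
  rw [hPL]
  exact hL

end Convergence

/-! ### Exponential quadratic moments of Gaussian vectors. -/

lemma lintegral_exp_gaussianReal {a : ℝ} (ha : a < 1) (b : ℝ) :
    ∫⁻ z, ENNReal.ofReal (Real.exp (a * z ^ 2 / 2 + b * z)) ∂(gaussianReal 0 1) =
      ENNReal.ofReal ((√(1 - a))⁻¹ * Real.exp (b ^ 2 / (2 * (1 - a)))) := by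
  have hs : 0 < 1 - a := sub_pos.2 ha
  set v : NNReal := ((1 - a)⁻¹).toNNReal
  have hv : (v : ℝ) = (1 - a)⁻¹ := Real.coe_toNNReal _ (inv_pos.2 hs).le
  have hv0 : v ≠ 0 := (Real.toNNReal_pos.2 (inv_pos.2 hs)).ne'
  rw [gaussianReal_of_var_ne_zero 0 one_ne_zero,
    lintegral_withDensity_eq_lintegral_mul _ (measurable_gaussianPDF 0 1) (by fun_prop)]
  -- The tilted density is a multiple of the Gaussian density with mean `b / (1 - a)` and variance
  -- `1 / (1 - a)`.
  have key : ∀ z : ℝ, (gaussianPDF 0 1 * fun z =>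
      ENNReal.ofReal (Real.exp (a * z ^ 2 / 2 + b * z))) z =
      ENNReal.ofReal ((√(1 - a))⁻¹ * Real.exp (b ^ 2 / (2 * (1 - a)))) *
        gaussianPDF (b / (1 - a)) v z := by
    intro z
    rw [Pi.mul_apply, gaussianPDF, gaussianPDF,
      ← ENNReal.ofReal_mul (gaussianPDFReal_nonneg _ _ _), ← ENNReal.ofReal_mul (by positivity)]
    congr 1
    simp only [gaussianPDFReal, hv, NNReal.coe_one]
    have h1 : √(2 * Real.pi * (1 - a)⁻¹) = √(2 * Real.pi * 1) * (√(1 - a))⁻¹ := by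
      rw [mul_one, Real.sqrt_mul (by positivity), Real.sqrt_inv]
    have h2 : (√(1 - a)) ≠ 0 := (Real.sqrt_pos.2 hs).ne'
    have h3 : Real.exp (-(z - 0) ^ 2 / (2 * 1)) * Real.exp (a * z ^ 2 / 2 + b * z) =
        Real.exp (b ^ 2 / (2 * (1 - a))) *
          Real.exp (-(z - b / (1 - a)) ^ 2 / (2 * (1 - a)⁻¹)) := by
      rw [← Real.exp_add, ← Real.exp_add]
      congr 1
      field_simp
      ring
    rw [h1, mul_assoc, h3]
    field_simp
  simp_rw [key]
  rw [lintegral_const_mul _ (measurable_gaussianPDF _ _), lintegral_gaussianPDF_eq_one _ hv0,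
    mul_one]

/-- The characteristic function sees `L` only through `L * Lᵀ`, so any factor of the covariance may
be used, not only its symmetric square root. -/
lemma multivariateGaussian_eq_map_pi {m : ℕ} {S L : Matrix (Fin m) (Fin m) ℝ}
    (hS : S.PosSemidef) (hL : L * Lᵀ = S) :
    multivariateGaussian 0 S =
      (Measure.pi fun _ : Fin m => gaussianReal 0 1).map fun z => WithLp.toLp 2 (L *ᵥ z) := by
  have h1 : (fun z : Fin m → ℝ => WithLp.toLp 2 (L *ᵥ z)) =
      (fun x => Matrix.toEuclideanCLM (𝕜 := ℝ) L x) ∘ WithLp.toLp 2 := rfl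
  rw [h1, ← Measure.map_map (by fun_prop) (by fun_prop), map_pi_eq_stdGaussian]
  apply Measure.ext_of_charFun
  ext t
  rw [charFun_multivariateGaussian hS, charFun_apply, integral_map (by fun_prop) (by fun_prop)]
  have h2 : ∀ x : EuclideanSpace ℝ (Fin m), inner ℝ (Matrix.toEuclideanCLM (𝕜 := ℝ) L x) t =
      inner ℝ x (WithLp.toLp 2 (Lᵀ *ᵥ t.ofLp)) := by
    intro x
    rw [real_inner_comm, Matrix.inner_toEuclideanCLM, EuclideanSpace.inner_eq_star_dotProduct,
      Matrix.dotProduct_mulVec, ← Matrix.mulVec_transpose]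
    simp
  simp_rw [h2]
  rw [← charFun_apply, charFun_stdGaussian, ← Complex.ofReal_pow]
  have h3 : (Lᵀ *ᵥ t.ofLp) ⬝ᵥ (Lᵀ *ᵥ t.ofLp) = t.ofLp ⬝ᵥ S *ᵥ t.ofLp := by
    rw [← hL, ← Matrix.mulVec_mulVec, Matrix.dotProduct_mulVec t.ofLp, ← Matrix.mulVec_transpose]
  have h4 : ‖WithLp.toLp 2 (Lᵀ *ᵥ t.ofLp)‖ ^ 2 = t.ofLp ⬝ᵥ S *ᵥ t.ofLp := by
    rw [← real_inner_self_eq_norm_sq, EuclideanSpace.inner_eq_star_dotProduct]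
    simpa using h3
  rw [h4]
  simp [neg_div]

-- Take `L = √S U` with `U` orthogonal and diagonalizing `√S X √S`. In these coordinates the
-- Gaussian integral splits into one-dimensional ones.
open scoped MatrixOrder in
lemma exists_diagonalizing_factor {m : ℕ} {S X : Matrix (Fin m) (Fin m) ℝ}
    (hS : S.PosSemidef) (hX : Xᵀ = X) :
    ∃ (L : Matrix (Fin m) (Fin m) ℝ) (δ : Fin m → ℝ),
      L * Lᵀ = S ∧ Lᵀ * X * L = Matrix.diagonal δ := by
  set T := CFC.sqrt S with hT
  have hTT : T * T = S := CFC.sqrt_mul_sqrt_self S hS.nonneg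
  have hTt : Tᵀ = T :=
    transpose_eq_of_posSemidef (Matrix.nonneg_iff_posSemidef.1 (CFC.sqrt_nonneg S))
  have hM : (T * X * T).IsHermitian := by
    simp [Matrix.IsHermitian, Matrix.conjTranspose_eq_transpose_of_trivial, hTt, hX,
      Matrix.mul_assoc]
  set U : Matrix (Fin m) (Fin m) ℝ := (hM.eigenvectorUnitary : Matrix (Fin m) (Fin m) ℝ) with hU
  have hUU : U * Uᵀ = 1 := Unitary.coe_mul_star_self hM.eigenvectorUnitary
  refine ⟨T * U, hM.eigenvalues, ?_, ?_⟩
  · rw [Matrix.transpose_mul, hTt, Matrix.mul_assoc, ← Matrix.mul_assoc U, hUU, Matrix.one_mul, hTT]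
  · have h := hM.conjStarAlgAut_star_eigenvectorUnitary
    rw [Unitary.conjStarAlgAut_apply] at h
    have h' : Uᵀ * (T * X * T) * U = Matrix.diagonal hM.eigenvalues := by
      simpa [Matrix.star_eq_conjTranspose, Matrix.conjTranspose_eq_transpose_of_trivial, hU,
        Function.comp_def] using h
    rw [← h', Matrix.transpose_mul, hTt]
    simp [Matrix.mul_assoc]

lemma gaussian_diagonalization {m : ℕ} {S X L : Matrix (Fin m) (Fin m) ℝ} {β : ℝ}
    {δ : Fin m → ℝ} (hS : S.PosDef) (hX : Xᵀ = X) (hpd : (S⁻¹ - β • X).PosDef)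
    (hL : L * Lᵀ = S) (hδ : Lᵀ * X * L = Matrix.diagonal δ) :
    (∀ i, 0 < 1 - β * δ i) ∧ (1 - β • (X * S)).det = ∏ i, (1 - β * δ i) ∧
      ∀ y, quad (tildeP S β X) y =
        quad X y + β * ∑ i, (Lᵀ *ᵥ (X *ᵥ y)) i ^ 2 / (1 - β * δ i) := by
  have hSu : IsUnit (L * Lᵀ).det := by rw [hL]; exact (Matrix.isUnit_iff_isUnit_det _).1 hS.isUnit
  have hLu : IsUnit L.det := by
    rw [Matrix.det_mul] at hSu
    exact isUnit_of_mul_isUnit_left hSu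
  have hLN : L * L⁻¹ = 1 := Matrix.mul_nonsing_inv L hLu
  have hNL : L⁻¹ * L = 1 := Matrix.nonsing_inv_mul L hLu
  have hLNt : L⁻¹ᵀ * Lᵀ = 1 := by rw [← Matrix.transpose_mul, hLN, Matrix.transpose_one]
  have hNLt : Lᵀ * L⁻¹ᵀ = 1 := by rw [← Matrix.transpose_mul, hNL, Matrix.transpose_one]
  have hSi : S⁻¹ = L⁻¹ᵀ * L⁻¹ := by
    apply Matrix.inv_eq_right_inv
    rw [← hL, Matrix.mul_assoc, ← Matrix.mul_assoc Lᵀ, hNLt, Matrix.one_mul, hLN]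
  have hDdiag : 1 - β • Matrix.diagonal δ = Matrix.diagonal fun i => 1 - β * δ i := by
    rw [← Matrix.diagonal_one, ← Matrix.diagonal_smul, Matrix.diagonal_sub]; rfl
  have hconj : Lᵀ * (S⁻¹ - β • X) * L = Matrix.diagonal fun i => 1 - β * δ i := by
    rw [← hDdiag, ← hδ, hSi, Matrix.mul_sub, Matrix.sub_mul, ← Matrix.mul_assoc, hNLt,
      Matrix.one_mul, hNL, Matrix.mul_smul, Matrix.smul_mul]
  have hpos : ∀ i, 0 < 1 - β * δ i := by
    have h : (Lᵀ * (S⁻¹ - β • X) * L).PosDef :=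
      hpd.conjTranspose_mul_mul_same (Matrix.mulVec_injective_of_isUnit
        ((Matrix.isUnit_iff_isUnit_det _).2 hLu))
    rw [hconj] at h
    exact Matrix.posDef_diagonal_iff.1 h
  have hdet : (1 - β • (X * S)).det = ∏ i, (1 - β * δ i) := by
    rw [← hL, ← Matrix.mul_assoc, ← Matrix.smul_mul, Matrix.det_one_sub_mul_comm, Matrix.mul_smul,
      ← Matrix.mul_assoc, hδ, hDdiag, Matrix.det_diagonal]
  have hinv : (S⁻¹ - β • X)⁻¹ = L * Matrix.diagonal (fun i => (1 - β * δ i)⁻¹) * Lᵀ := by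
    apply Matrix.inv_eq_right_inv
    have h1 : S⁻¹ - β • X = L⁻¹ᵀ * (Matrix.diagonal fun i => 1 - β * δ i) * L⁻¹ := by
      rw [← hconj]
      calc S⁻¹ - β • X = (L⁻¹ᵀ * Lᵀ) * (S⁻¹ - β • X) * (L * L⁻¹) := by
            rw [hLN, hLNt, Matrix.one_mul, Matrix.mul_one]
        _ = _ := by simp only [Matrix.mul_assoc]
    have h2 : (Matrix.diagonal fun i => 1 - β * δ i) * Matrix.diagonal (fun i => (1 - β * δ i)⁻¹)
        = 1 := by
      rw [Matrix.diagonal_mul_diagonal, ← Matrix.diagonal_one]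
      congr 1
      ext i
      exact mul_inv_cancel₀ (hpos i).ne'
    rw [h1]
    calc _ = L⁻¹ᵀ * ((Matrix.diagonal fun i => 1 - β * δ i) * ((L⁻¹ * L) *
          Matrix.diagonal (fun i => (1 - β * δ i)⁻¹))) * Lᵀ := by simp only [Matrix.mul_assoc]
      _ = 1 := by rw [hNL, Matrix.one_mul, h2, Matrix.mul_one, hLNt]
  refine ⟨hpos, hdet, fun y => ?_⟩
  have h1 : X * (S⁻¹ - β • X)⁻¹ * X = (Lᵀ * X)ᵀ * Matrix.diagonal (fun i => (1 - β * δ i)⁻¹) *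
      (Lᵀ * X) := by
    rw [hinv, Matrix.transpose_mul, hX, Matrix.transpose_transpose]
    simp only [Matrix.mul_assoc]
  rw [tildeP, quad_matrix_add, quad_matrix_smul, h1, quad_conj, ← Matrix.mulVec_mulVec]
  congr 2
  simp only [quad, dotProduct, Matrix.mulVec_diagonal]
  refine Finset.sum_congr rfl fun i _ => ?_
  rw [div_eq_mul_inv]; ring

lemma quad_add_mulVec_of_diagonal {m : ℕ} {X L : Matrix (Fin m) (Fin m) ℝ}
    {δ : Fin m → ℝ} (hX : Xᵀ = X) (hδ : Lᵀ * X * L = Matrix.diagonal δ) (y z : Fin m → ℝ) :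
    quad X (y + L *ᵥ z) =
      quad X y + ∑ i, (δ i * z i ^ 2 + 2 * ((Lᵀ *ᵥ (X *ᵥ y)) i * z i)) := by
  have h1 : y ⬝ᵥ (X *ᵥ (L *ᵥ z)) = (Lᵀ *ᵥ (X *ᵥ y)) ⬝ᵥ z := by
    rw [dotProduct_mulVec_comm hX, Matrix.mulVec_transpose, ← Matrix.dotProduct_mulVec,
      dotProduct_comm]
  have h2 : quad X (L *ᵥ z) = ∑ i, δ i * z i ^ 2 := by
    rw [← quad_conj, hδ]
    simp only [quad, dotProduct, Matrix.mulVec_diagonal]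
    exact Finset.sum_congr rfl fun i _ => by ring
  rw [quad_add hX, h1, h2, Finset.sum_add_distrib, ← Finset.mul_sum]
  simp only [dotProduct]
  ring

lemma measurable_exp_quadratic (a b : ℝ) :
    Measurable fun t : ℝ => ENNReal.ofReal (Real.exp (a * t ^ 2 / 2 + b * t)) := by fun_prop

lemma lintegral_pi_prod_exp {m : ℕ} {a b : Fin m → ℝ} (ha : ∀ i, a i < 1) :
    ∫⁻ z : Fin m → ℝ, ∏ i, ENNReal.ofReal (Real.exp (a i * z i ^ 2 / 2 + b i * z i))
      ∂(Measure.pi fun _ : Fin m => gaussianReal 0 1) =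
    ∏ i, ENNReal.ofReal ((√(1 - a i))⁻¹ * Real.exp (b i ^ 2 / (2 * (1 - a i)))) := by
  set f : Fin m → ℝ → ENNReal :=
    fun i t => ENNReal.ofReal (Real.exp (a i * t ^ 2 / 2 + b i * t)) with hf
  have hm : ∀ i, Measurable (f i) := fun i => measurable_exp_quadratic (a i) (b i)
  have hind := iIndepFun_pi (μ := fun _ : Fin m => gaussianReal 0 1) (X := f)
    fun i => (hm i).aemeasurable
  have h := lintegral_prod_eq_prod_lintegral_of_indepFun Finset.univ _ hind
    fun i => (hm i).comp (measurable_pi_apply i)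
  refine h.trans (Finset.prod_congr rfl fun i _ => ?_)
  refine Eq.trans ?_ (lintegral_exp_gaussianReal (ha i) (b i))
  exact (measurePreserving_eval (fun _ : Fin m => gaussianReal 0 1) i).lintegral_comp (hm i)

lemma measurable_quad {n : ℕ} (X : Matrix (Fin n) (Fin n) ℝ) : Measurable (quad X) := by
  have : Continuous (quad X) := by unfold quad; fun_prop
  exact this.measurable

lemma measurable_exp_quad {n : ℕ} (β : ℝ) (X : Matrix (Fin n) (Fin n) ℝ) (y : Fin n → ℝ) :
    Measurable fun w : EuclideanSpace ℝ (Fin n) =>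
      ENNReal.ofReal (Real.exp (β / 2 * quad X (y + w.ofLp))) := by
  have h1 : Measurable fun w : EuclideanSpace ℝ (Fin n) => y + w.ofLp := by fun_prop
  have h2 := (measurable_quad X).comp h1
  exact (Real.measurable_exp.comp (h2.const_mul (β / 2))).ennreal_ofReal

/-- The exponential moment of a shifted quadratic form of a Gaussian vector. -/
theorem lintegral_exp_quad_multivariateGaussian {m : ℕ} {S X : Matrix (Fin m) (Fin m) ℝ} {β : ℝ}
    (hS : S.PosDef) (hX : Xᵀ = X) (hpd : (S⁻¹ - β • X).PosDef) (y : Fin m → ℝ) :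
    0 < (1 - β • (X * S)).det ∧
    ∫⁻ w, ENNReal.ofReal (Real.exp (β / 2 * quad X (y + w.ofLp))) ∂(multivariateGaussian 0 S) =
      ENNReal.ofReal ((√(1 - β • (X * S)).det)⁻¹ * Real.exp (β / 2 * quad (tildeP S β X) y)) := by
  obtain ⟨L, δ, hL, hδ⟩ := exists_diagonalizing_factor hS.posSemidef hX
  obtain ⟨hpos, hdet, htilde⟩ := gaussian_diagonalization hS hX hpd hL hδ
  have hexp := quad_add_mulVec_of_diagonal hX hδ y
  have htilde := htilde y
  set b : Fin m → ℝ := Lᵀ *ᵥ (X *ᵥ y) with hb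
  refine ⟨by rw [hdet]; exact Finset.prod_pos fun i _ => hpos i, ?_⟩
  rw [multivariateGaussian_eq_map_pi hS.posSemidef hL, lintegral_map (measurable_exp_quad β X y) (by fun_prop)]
  have hprod : ∀ z : Fin m → ℝ,
      ENNReal.ofReal (Real.exp (β / 2 * quad X (y + L *ᵥ z))) =
      ENNReal.ofReal (Real.exp (β / 2 * quad X y)) *
        ∏ i, ENNReal.ofReal (Real.exp (β * δ i * z i ^ 2 / 2 + β * b i * z i)) := by
    intro z
    rw [← ENNReal.ofReal_prod_of_nonneg fun i _ => (Real.exp_pos _).le, ← Real.exp_sum,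
      ← ENNReal.ofReal_mul (Real.exp_pos _).le, ← Real.exp_add, hexp, mul_add, Finset.mul_sum]
    congr 4
    ext i
    ring
  simp_rw [hprod]
  rw [lintegral_const_mul' _ _ ENNReal.ofReal_ne_top,
    lintegral_pi_prod_exp (fun i => by linarith [hpos i])]
  rw [← ENNReal.ofReal_prod_of_nonneg fun i _ => by positivity,
    ← ENNReal.ofReal_mul (Real.exp_pos _).le, Finset.prod_mul_distrib, ← Real.exp_sum, hdet,
    Real.sqrt_prod _ fun i _ => (hpos i).le, ← Finset.prod_inv_distrib, htilde]
  congr 1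
  rw [mul_left_comm, ← Real.exp_add, mul_add]
  congr 3
  rw [Finset.mul_sum, Finset.mul_sum]
  refine Finset.sum_congr rfl fun i _ => ?_
  have := (hpos i).ne'
  field_simp

/-! ### Measurability and causality of the controlled system. -/

section Dynamics

variable {m d : ℕ} {A : Matrix (Fin m) (Fin m) ℝ} {B : Matrix (Fin m) (Fin d) ℝ}
  {Q : Matrix (Fin m) (Fin m) ℝ} {R : Matrix (Fin d) (Fin d) ℝ} {μ : Policy m d}

lemma measurable_history (hμ : μ.IsMeasurable) (t : ℕ) :
    Measurable fun p : Vec m × (ℕ → Vec m) => history A B μ p.1 p.2 t := by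
  induction t with
  | zero => exact measurable_const.prodMk measurable_fst
  | succ t ih =>
    have hx : Measurable fun p : Vec m × (ℕ → Vec m) => (history A B μ p.1 p.2 t).2 := ih.snd
    have hu : Measurable fun p : Vec m × (ℕ → Vec m) =>
        μ t (history A B μ p.1 p.2 t).1 (history A B μ p.1 p.2 t).2 := (hμ t).comp ih
    refine Measurable.prodMk (measurable_pi_iff.2 fun i => ?_) ?_
    · refine Fin.lastCases ?_ (fun j => ?_) i
      · simpa [history] using hx.prodMk hu
      · simpa [history, Function.comp_def] using (measurable_pi_apply j).comp ih.fst
    · have h1 : Measurable fun q : Vec m × Vec d =>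
          (WithLp.toLp 2 (A *ᵥ q.1.ofLp + B *ᵥ q.2.ofLp) : Vec m) := by
        have : Continuous fun q : Vec m × Vec d =>
          (WithLp.toLp 2 (A *ᵥ q.1.ofLp + B *ᵥ q.2.ofLp) : Vec m) := by fun_prop
        exact this.measurable
      exact (h1.comp (hx.prodMk hu)).add ((measurable_pi_apply t).comp measurable_snd)

lemma history_congr (x : Vec m) {w w' : ℕ → Vec m} {t : ℕ} (h : ∀ s < t, w s = w' s) :
    history A B μ x w t = history A B μ x w' t := by
  induction t with
  | zero => rfl
  | succ t ih =>
    have h1 := ih fun s hs => h s (hs.trans t.lt_succ_self)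
    simp only [history]
    rw [h1, h t t.lt_succ_self]

/-- The cost accumulated over the first `n` stages, as a function of the primitive randomness. -/
def costSum (A : Matrix (Fin m) (Fin m) ℝ) (B : Matrix (Fin m) (Fin d) ℝ)
    (Q : Matrix (Fin m) (Fin m) ℝ) (R : Matrix (Fin d) (Fin d) ℝ) (μ : Policy m d) (n : ℕ)
    (p : Vec m × (ℕ → Vec m)) : ℝ :=
  ∑ t ∈ Finset.range n, stageCost Q R (stateAt A B μ p.1 p.2 t) (controlAt A B μ p.1 p.2 t)

/-- The conditional mean of the next state. -/
def predictedState (A : Matrix (Fin m) (Fin m) ℝ) (B : Matrix (Fin m) (Fin d) ℝ)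
    (μ : Policy m d) (n : ℕ) (p : Vec m × (ℕ → Vec m)) : Fin m → ℝ :=
  A *ᵥ (stateAt A B μ p.1 p.2 n).ofLp + B *ᵥ (controlAt A B μ p.1 p.2 n).ofLp

lemma measurable_stateAt (hμ : μ.IsMeasurable) (t : ℕ) :
    Measurable fun p : Vec m × (ℕ → Vec m) => stateAt A B μ p.1 p.2 t :=
  (measurable_history hμ t).snd

lemma measurable_controlAt (hμ : μ.IsMeasurable) (t : ℕ) :
    Measurable fun p : Vec m × (ℕ → Vec m) => controlAt A B μ p.1 p.2 t :=
  (hμ t).comp (measurable_history hμ t)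

lemma measurable_ofLp (n : ℕ) : Measurable fun x : Vec n => x.ofLp := by fun_prop

lemma measurable_costSum (hμ : μ.IsMeasurable) (n : ℕ) : Measurable (costSum A B Q R μ n) := by
  refine Finset.measurable_sum _ fun t _ => ?_
  exact ((measurable_quad Q).comp ((measurable_ofLp m).comp (measurable_stateAt hμ t))).add
    ((measurable_quad R).comp ((measurable_ofLp d).comp (measurable_controlAt hμ t)))

lemma measurable_predictedState (hμ : μ.IsMeasurable) (n : ℕ) :
    Measurable (predictedState A B μ n) := by
  have h1 : Measurable fun q : Vec m × Vec d => A *ᵥ q.1.ofLp + B *ᵥ q.2.ofLp := by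
    have : Continuous fun q : Vec m × Vec d => A *ᵥ q.1.ofLp + B *ᵥ q.2.ofLp := by fun_prop
    exact this.measurable
  exact h1.comp ((measurable_stateAt hμ n).prodMk (measurable_controlAt hμ n))

/-- The cost of `n + 1` stages involves states only up to `x_n`, hence disturbances only before time
`n`; `w_n` is still fresh. -/
lemma costSum_congr (x : Vec m) {w w' : ℕ → Vec m} {n : ℕ} (h : ∀ s < n, w s = w' s) :
    costSum A B Q R μ (n + 1) (x, w) = costSum A B Q R μ (n + 1) (x, w') := by
  refine Finset.sum_congr rfl fun t ht => ?_
  have h1 : history A B μ x w t = history A B μ x w' t :=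
    history_congr x fun s hs => h s (by have := Finset.mem_range.1 ht; omega)
  simp only [stateAt, controlAt, h1]

lemma predictedState_congr (x : Vec m) {w w' : ℕ → Vec m} {n : ℕ} (h : ∀ s < n, w s = w' s) :
    predictedState A B μ n (x, w) = predictedState A B μ n (x, w') := by
  simp only [predictedState, stateAt, controlAt, history_congr x h]

lemma linearFeedback_isMeasurable (K : Matrix (Fin d) (Fin m) ℝ) :
    (linearFeedback K).IsMeasurable := by
  intro t
  have : Continuous fun x : Vec m => (WithLp.toLp 2 (-(K *ᵥ x.ofLp)) : Vec d) := by fun_prop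
  exact this.measurable.comp measurable_snd

end Dynamics

/-! ### Dynamic programming for exponential moments. -/

section Moments

variable {m d : ℕ} {A : Matrix (Fin m) (Fin m) ℝ} {B : Matrix (Fin m) (Fin d) ℝ}
  {Q : Matrix (Fin m) (Fin m) ℝ} {R : Matrix (Fin d) (Fin d) ℝ} {μ : Policy m d}
  {X₀ W : Matrix (Fin m) (Fin m) ℝ} {β : ℝ}
  {Ω : Type*} [MeasurableSpace Ω] {Pr : Measure Ω}
  {x₀ : Ω → Vec m} {w : ℕ → Ω → Vec m}

/-- The primitive randomness. -/
def noise (x₀ : Ω → Vec m) (w : ℕ → Ω → Vec m) (ω : Ω) : Vec m × (ℕ → Vec m) :=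
  (x₀ ω, fun s => w s ω)

lemma aemeasurable_noise (hx₀ : AEMeasurable x₀ Pr) (hw : ∀ t, AEMeasurable (w t) Pr) :
    AEMeasurable (noise x₀ w) Pr :=
  hx₀.prodMk (aemeasurable_pi_iff.2 hw)

lemma indepFun_past_noise {E : Type*} [MeasurableSpace E]
    (hx₀ : AEMeasurable x₀ Pr) (hw : ∀ t, AEMeasurable (w t) Pr)
    (hindep : iIndepFun (fun i : Option ℕ => i.elim x₀ w) Pr)
    {Z : Vec m × (ℕ → Vec m) → E} (hZ : Measurable Z) (n : ℕ)
    (hloc : ∀ x v v', (∀ s < n, v s = v' s) → Z (x, v) = Z (x, v')) :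
    IndepFun (fun ω => Z (noise x₀ w ω)) (w n) Pr := by
  classical
  set S : Finset (Option ℕ) := insert none ((Finset.range n).image some) with hS
  have hmem : ∀ s, s < n → (some s : Option ℕ) ∈ S := fun s hs => by simp [hS, hs]
  have hnone : (none : Option ℕ) ∈ S := by simp [hS]
  have hdisj : Disjoint S {some n} := by simp [hS]
  have hmeas : ∀ i : Option ℕ, AEMeasurable (i.elim x₀ w) Pr := by
    rintro (_ | i)
    · exact hx₀
    · exact hw i
  have h := hindep.indepFun_finset₀ S {some n} hdisj hmeas
  -- Rebuild the randomness from `x₀` and the first `n` disturbances; the other coordinates are set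
  -- to `0`, which `Z` does not notice.
  set φ : (S → Vec m) → Vec m × (ℕ → Vec m) := fun g =>
    (g ⟨none, hnone⟩, fun s => if hs : s < n then g ⟨some s, hmem s hs⟩ else 0) with hφ
  have hφm : Measurable φ := by
    refine (measurable_pi_apply _).prodMk (measurable_pi_iff.2 fun s => ?_)
    by_cases hs : s < n
    · simp only [hs, dif_pos]; exact measurable_pi_apply _
    · simp only [hs, dif_neg, not_false_eq_true]; exact measurable_const
  have h2 := h.comp (hZ.comp hφm)
    (measurable_pi_apply (⟨some n, by simp⟩ : ({some n} : Finset (Option ℕ))))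
  convert! h2 using 1
  ext ω
  refine hloc _ _ _ fun s hs => ?_
  simp [hs]

lemma lintegral_past_noise {E : Type*} [MeasurableSpace E]
    (hx₀ : AEMeasurable x₀ Pr) (hw : ∀ t, HasLaw (w t) (multivariateGaussian 0 W) Pr)
    (hindep : iIndepFun (fun i : Option ℕ => i.elim x₀ w) Pr)
    {Z : Vec m × (ℕ → Vec m) → E} (hZ : Measurable Z) (n : ℕ)
    (hloc : ∀ x v v', (∀ s < n, v s = v' s) → Z (x, v) = Z (x, v'))
    {F : E × Vec m → ENNReal} (hF : Measurable F) :
    ∫⁻ ω, F (Z (noise x₀ w ω), w n ω) ∂Pr =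
      ∫⁻ ω, ∫⁻ v, F (Z (noise x₀ w ω), v) ∂(multivariateGaussian 0 W) ∂Pr := by
  have := hindep.isProbabilityMeasure
  have hwm := fun t => (hw t).aemeasurable
  have hZm : AEMeasurable (fun ω => Z (noise x₀ w ω)) Pr :=
    hZ.comp_aemeasurable (aemeasurable_noise hx₀ hwm)
  have h := (indepFun_past_noise hx₀ hwm hindep hZ n hloc).map_prod_eq_prod_map_map hZm (hwm n)
  rw [(hw n).map_eq] at h
  rw [← lintegral_map' hF.aemeasurable (hZm.prodMk (hwm n)), h, lintegral_prod _ hF.aemeasurable,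
    lintegral_map' hF.lintegral_prod_right'.aemeasurable hZm]

/-- The exponential moment of the cost of `n` stages with terminal cost `xᵀ X x`. -/
def expMoment (A : Matrix (Fin m) (Fin m) ℝ) (B : Matrix (Fin m) (Fin d) ℝ)
    (Q : Matrix (Fin m) (Fin m) ℝ) (R : Matrix (Fin d) (Fin d) ℝ) (β : ℝ) (Pr : Measure Ω)
    (x₀ : Ω → Vec m) (w : ℕ → Ω → Vec m) (μ : Policy m d) (n : ℕ)
    (X : Matrix (Fin m) (Fin m) ℝ) : ENNReal :=
  ∫⁻ ω, ENNReal.ofReal (Real.exp (β / 2 * (costSum A B Q R μ n (noise x₀ w ω) +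
    quad X (stateAt A B μ (noise x₀ w ω).1 (noise x₀ w ω).2 n).ofLp))) ∂Pr

/-- The factor contributed by the noise of one stage. -/
def noiseFactor (W : Matrix (Fin m) (Fin m) ℝ) (β : ℝ) (X : Matrix (Fin m) (Fin m) ℝ) : ℝ :=
  (√(1 - β • (X * W)).det)⁻¹

lemma det_pos_of_admissible {X : Matrix (Fin m) (Fin m) ℝ} (hW : W.PosDef)
    (hX : Admissible W β X) : 0 < (1 - β • (X * W)).det :=
  (lintegral_exp_quad_multivariateGaussian hW (transpose_eq_of_posSemidef hX.posSemidef)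
    hX.posDef 0).1

lemma noiseFactor_pos {X : Matrix (Fin m) (Fin m) ℝ} (hW : W.PosDef) (hX : Admissible W β X) :
    0 < noiseFactor W β X :=
  inv_pos.2 (Real.sqrt_pos.2 (det_pos_of_admissible hW hX))

/-- Conditionally on the past, `x_{n+1}` is the predicted state plus the independent `w_n`. The
Gaussian moment formula turns `X` into `P̃(X)` at the predicted state, and
`control_square_completion` does the rest. -/
lemma expMoment_succ (hβ : β ≠ 0) (hR : R.PosDef) (hW : W.PosDef) (hμ : μ.IsMeasurable)
    (hx₀ : AEMeasurable x₀ Pr) (hw : ∀ t, HasLaw (w t) (multivariateGaussian 0 W) Pr)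
    (hindep : iIndepFun (fun i : Option ℕ => i.elim x₀ w) Pr)
    {X : Matrix (Fin m) (Fin m) ℝ} (hX : Admissible W β X) (n : ℕ) :
    expMoment A B Q R β Pr x₀ w μ (n + 1) X = ENNReal.ofReal (noiseFactor W β X) *
      ∫⁻ ω, ENNReal.ofReal (Real.exp (β / 2 * (costSum A B Q R μ n (noise x₀ w ω) +
        quad (riccatiMap A B Q R W β X)
          (stateAt A B μ (noise x₀ w ω).1 (noise x₀ w ω).2 n).ofLp +
        quad (R + Bᵀ * tildeP W β X * B)
          ((controlAt A B μ (noise x₀ w ω).1 (noise x₀ w ω).2 n).ofLp + riccatiGain A B R W β X *ᵥ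
            (stateAt A B μ (noise x₀ w ω).1 (noise x₀ w ω).2 n).ofLp)))) ∂Pr := by
  have hZ : Measurable fun p : Vec m × (ℕ → Vec m) =>
      (costSum A B Q R μ (n + 1) p, predictedState A B μ n p) :=
    (measurable_costSum hμ _).prodMk (measurable_predictedState hμ n)
  have hF : Measurable fun q : (ℝ × (Fin m → ℝ)) × Vec m =>
      ENNReal.ofReal (Real.exp (β / 2 * (q.1.1 + quad X (q.1.2 + q.2.ofLp)))) := by
    have h1 : Measurable fun q : (ℝ × (Fin m → ℝ)) × Vec m => q.1.2 + q.2.ofLp :=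
      measurable_fst.snd.add ((measurable_ofLp m).comp measurable_snd)
    have h2 := (measurable_fst.fst.add ((measurable_quad X).comp h1)).const_mul (β / 2)
    exact (Real.measurable_exp.comp h2).ennreal_ofReal
  have h := lintegral_past_noise hx₀ hw hindep hZ n
    (fun x v v' hv => by rw [costSum_congr x hv, predictedState_congr x hv]) hF
  have h0 : expMoment A B Q R β Pr x₀ w μ (n + 1) X = ∫⁻ ω, ENNReal.ofReal (Real.exp (β / 2 *
      (costSum A B Q R μ (n + 1) (noise x₀ w ω) +
        quad X (predictedState A B μ n (noise x₀ w ω) + (w n ω).ofLp)))) ∂Pr := rfl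
  rw [h0, h, ← lintegral_const_mul' _ _ ENNReal.ofReal_ne_top]
  refine lintegral_congr fun ω => ?_
  have hG := (lintegral_exp_quad_multivariateGaussian hW
    (transpose_eq_of_posSemidef hX.posSemidef) hX.posDef
    (predictedState A B μ n (noise x₀ w ω))).2
  simp_rw [mul_add (β / 2) (costSum A B Q R μ (n + 1) (noise x₀ w ω)), Real.exp_add,
    ENNReal.ofReal_mul (Real.exp_pos _).le]
  rw [lintegral_const_mul' _ _ ENNReal.ofReal_ne_top, hG,
    ← ENNReal.ofReal_mul (Real.exp_pos _).le,
    ← ENNReal.ofReal_mul (noiseFactor_pos hW hX).le]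
  congr 1
  rw [mul_left_comm, ← Real.exp_add, ← mul_add]
  have hsq := control_square_completion (A := A) (B := B) (Q := Q) hβ hR hW hX
    (stateAt A B μ (noise x₀ w ω).1 (noise x₀ w ω).2 n).ofLp
    (controlAt A B μ (noise x₀ w ω).1 (noise x₀ w ω).2 n).ofLp
  have hc : costSum A B Q R μ (n + 1) (noise x₀ w ω) = costSum A B Q R μ n (noise x₀ w ω) +
      (quad Q (stateAt A B μ (noise x₀ w ω).1 (noise x₀ w ω).2 n).ofLp +
        quad R (controlAt A B μ (noise x₀ w ω).1 (noise x₀ w ω).2 n).ofLp) :=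
    Finset.sum_range_succ _ _
  rw [noiseFactor, add_assoc (costSum A B Q R μ n (noise x₀ w ω)), ← hsq, hc]
  simp only [predictedState, add_assoc]

lemma expMoment_linearFeedback (hβ : β ≠ 0) (hR : R.PosDef) (hW : W.PosDef)
    (hx₀ : AEMeasurable x₀ Pr) (hw : ∀ t, HasLaw (w t) (multivariateGaussian 0 W) Pr)
    (hindep : iIndepFun (fun i : Option ℕ => i.elim x₀ w) Pr)
    {P : Matrix (Fin m) (Fin m) ℝ} (hP : Admissible W β P)
    (hfix : riccatiMap A B Q R W β P = P) (n : ℕ) :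
    expMoment A B Q R β Pr x₀ w (linearFeedback (riccatiGain A B R W β P)) n P =
      ENNReal.ofReal (noiseFactor W β P ^ n) *
        expMoment A B Q R β Pr x₀ w (linearFeedback (riccatiGain A B R W β P)) 0 P := by
  induction n with
  | zero => simp
  | succ n ih =>
    rw [expMoment_succ hβ hR hW (linearFeedback_isMeasurable _) hx₀ hw hindep hP, hfix, pow_succ',
      ENNReal.ofReal_mul (noiseFactor_pos hW hP).le, mul_assoc, ← ih]
    congr 1
    refine lintegral_congr fun ω => ?_
    have hu : (controlAt A B (linearFeedback (riccatiGain A B R W β P)) (noise x₀ w ω).1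
        (noise x₀ w ω).2 n).ofLp + riccatiGain A B R W β P *ᵥ (stateAt A B
        (linearFeedback (riccatiGain A B R W β P)) (noise x₀ w ω).1 (noise x₀ w ω).2 n).ofLp = 0 :=
      neg_add_cancel _
    rw [hu, quad_zero, add_zero]

lemma expMoment_succ_ge (hβ : 0 < β) (hR : R.PosDef) (hW : W.PosDef) (hμ : μ.IsMeasurable)
    (hx₀ : AEMeasurable x₀ Pr) (hw : ∀ t, HasLaw (w t) (multivariateGaussian 0 W) Pr)
    (hindep : iIndepFun (fun i : Option ℕ => i.elim x₀ w) Pr)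
    {X : Matrix (Fin m) (Fin m) ℝ} (hX : Admissible W β X) (n : ℕ) :
    ENNReal.ofReal (noiseFactor W β X) *
      expMoment A B Q R β Pr x₀ w μ n (riccatiMap A B Q R W β X) ≤
      expMoment A B Q R β Pr x₀ w μ (n + 1) X := by
  rw [expMoment_succ hβ.ne' hR hW hμ hx₀ hw hindep hX]
  refine mul_le_mul_right (lintegral_mono fun ω => ?_) _
  have h := quad_nonneg (gain_denominator_posDef (B := B) hβ.ne' hR hW hX).posSemidef
    ((controlAt A B μ (noise x₀ w ω).1 (noise x₀ w ω).2 n).ofLp + riccatiGain A B R W β X *ᵥ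
      (stateAt A B μ (noise x₀ w ω).1 (noise x₀ w ω).2 n).ofLp)
  refine ENNReal.ofReal_le_ofReal (Real.exp_le_exp.2 (mul_le_mul_of_nonneg_left ?_ (by positivity)))
  linarith

lemma expMoment_succ_le (hβ : β < 0) (hR : R.PosDef) (hW : W.PosDef) (hμ : μ.IsMeasurable)
    (hx₀ : AEMeasurable x₀ Pr) (hw : ∀ t, HasLaw (w t) (multivariateGaussian 0 W) Pr)
    (hindep : iIndepFun (fun i : Option ℕ => i.elim x₀ w) Pr)
    {X : Matrix (Fin m) (Fin m) ℝ} (hX : Admissible W β X) (n : ℕ) :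
    expMoment A B Q R β Pr x₀ w μ (n + 1) X ≤ ENNReal.ofReal (noiseFactor W β X) *
      expMoment A B Q R β Pr x₀ w μ n (riccatiMap A B Q R W β X) := by
  rw [expMoment_succ hβ.ne hR hW hμ hx₀ hw hindep hX]
  refine mul_le_mul_right (lintegral_mono fun ω => ?_) _
  have h := quad_nonneg (gain_denominator_posDef (B := B) hβ.ne hR hW hX).posSemidef
    ((controlAt A B μ (noise x₀ w ω).1 (noise x₀ w ω).2 n).ofLp + riccatiGain A B R W β X *ᵥ
      (stateAt A B μ (noise x₀ w ω).1 (noise x₀ w ω).2 n).ofLp)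
  refine ENNReal.ofReal_le_ofReal (Real.exp_le_exp.2 (mul_le_mul_of_nonpos_left ?_ (by linarith)))
  linarith

lemma prod_noiseFactor_succ {P : Matrix (Fin m) (Fin m) ℝ} (hW : W.PosDef)
    (hP : Admissible W β P) (u : ℕ → Matrix (Fin m) (Fin m) ℝ) (n k : ℕ) (hu : u k = P)
    (I : ENNReal) :
    ENNReal.ofReal (∏ j ∈ Finset.range (n + 1), noiseFactor W β (u (k + j))) * I =
      ENNReal.ofReal (noiseFactor W β P) *
        (ENNReal.ofReal (∏ j ∈ Finset.range n, noiseFactor W β (u (k + 1 + j))) * I) := by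
  rw [Finset.prod_range_succ', add_zero, hu, mul_comm (∏ j ∈ _, _),
    ENNReal.ofReal_mul (noiseFactor_pos hW hP).le, mul_assoc]
  simp only [add_assoc, add_comm 1]

/-- Each removed stage turns the terminal weight `X_k` into `X_{k+1}`, so the induction on the
horizon must hold for all starting indices `k`. -/
lemma expMoment_ge_prod (hβ : 0 < β) (hR : R.PosDef) (hW : W.PosDef)
    (hμ : μ.IsMeasurable)
    (hx₀ : AEMeasurable x₀ Pr) (hw : ∀ t, HasLaw (w t) (multivariateGaussian 0 W) Pr)
    (hindep : iIndepFun (fun i : Option ℕ => i.elim x₀ w) Pr)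
    (hadm : ∀ k, Admissible W β (riccatiIter A B Q R W β k)) (n k : ℕ) :
    ENNReal.ofReal (∏ j ∈ Finset.range n, noiseFactor W β (riccatiIter A B Q R W β (k + j))) *
        expMoment A B Q R β Pr x₀ w μ 0 (riccatiIter A B Q R W β (k + n)) ≤
      expMoment A B Q R β Pr x₀ w μ n (riccatiIter A B Q R W β k) := by
  induction n generalizing k with
  | zero => simp
  | succ n ih =>
    rw [prod_noiseFactor_succ hW (hadm k) _ n k rfl]
    refine le_trans (mul_le_mul_right ?_ _)
      (expMoment_succ_ge hβ hR hW hμ hx₀ hw hindep (hadm k) n)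
    have := ih (k + 1)
    rwa [add_assoc k 1 n, add_comm 1 n] at this

lemma expMoment_le_prod (hβ : β < 0) (hR : R.PosDef) (hW : W.PosDef)
    (hμ : μ.IsMeasurable)
    (hx₀ : AEMeasurable x₀ Pr) (hw : ∀ t, HasLaw (w t) (multivariateGaussian 0 W) Pr)
    (hindep : iIndepFun (fun i : Option ℕ => i.elim x₀ w) Pr)
    (hadm : ∀ k, Admissible W β (riccatiIter A B Q R W β k)) (n k : ℕ) :
    expMoment A B Q R β Pr x₀ w μ n (riccatiIter A B Q R W β k) ≤
    ENNReal.ofReal (∏ j ∈ Finset.range n, noiseFactor W β (riccatiIter A B Q R W β (k + j))) *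
        expMoment A B Q R β Pr x₀ w μ 0 (riccatiIter A B Q R W β (k + n)) := by
  induction n generalizing k with
  | zero => simp
  | succ n ih =>
    rw [prod_noiseFactor_succ hW (hadm k) _ n k rfl]
    refine le_trans (expMoment_succ_le hβ hR hW hμ hx₀ hw hindep (hadm k) n)
      (mul_le_mul_right ?_ _)
    have := ih (k + 1)
    rwa [add_assoc k 1 n, add_comm 1 n] at this

lemma expMoment_zero_ge_one [IsProbabilityMeasure Pr] (hβ : 0 < β) {X : Matrix (Fin m) (Fin m) ℝ} (hX : X.PosSemidef) :
    1 ≤ expMoment A B Q R β Pr x₀ w μ 0 X := by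
  rw [← measure_univ (μ := Pr), ← lintegral_one]
  refine lintegral_mono fun ω => ?_
  rw [← ENNReal.ofReal_one, costSum, Finset.sum_range_zero, zero_add]
  refine ENNReal.ofReal_le_ofReal (Real.one_le_exp (mul_nonneg (by positivity) (quad_nonneg hX _)))

lemma expMoment_zero_le_one [IsProbabilityMeasure Pr] (hβ : β < 0) {X : Matrix (Fin m) (Fin m) ℝ} (hX : X.PosSemidef) :
    expMoment A B Q R β Pr x₀ w μ 0 X ≤ 1 := by
  rw [← measure_univ (μ := Pr), ← lintegral_one]
  refine lintegral_mono fun ω => ?_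
  rw [← ENNReal.ofReal_one, costSum, Finset.sum_range_zero, zero_add]
  refine ENNReal.ofReal_le_ofReal (Real.exp_le_one_iff.2
    (mul_nonpos_of_nonpos_of_nonneg (by linarith) (quad_nonneg hX _)))

lemma expMoment_terminal_le (hβ : 0 < β) {X : Matrix (Fin m) (Fin m) ℝ} (hX : X.PosSemidef)
    (n : ℕ) : expMoment A B Q R β Pr x₀ w μ n 0 ≤ expMoment A B Q R β Pr x₀ w μ n X := by
  refine lintegral_mono fun ω => ENNReal.ofReal_le_ofReal (Real.exp_le_exp.2
    (mul_le_mul_of_nonneg_left (add_le_add_right ?_ _) (by positivity)))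
  simpa [quad] using quad_nonneg hX _

lemma expMoment_terminal_ge (hβ : β < 0) {X : Matrix (Fin m) (Fin m) ℝ} (hX : X.PosSemidef)
    (n : ℕ) : expMoment A B Q R β Pr x₀ w μ n X ≤ expMoment A B Q R β Pr x₀ w μ n 0 := by
  refine lintegral_mono fun ω => ENNReal.ofReal_le_ofReal (Real.exp_le_exp.2
    (mul_le_mul_of_nonpos_left (add_le_add_right ?_ _) (by linarith)))
  simpa [quad] using quad_nonneg hX _

/-- The only use of the condition on `X₀`: it makes the initial moment with terminal weight `P`
finite and positive. -/
lemma exists_expMoment_zero_eq (hX₀ : X₀.PosDef) (hx₀ : HasLaw x₀ (multivariateGaussian 0 X₀) Pr)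
    {P : Matrix (Fin m) (Fin m) ℝ} (hP : P.PosSemidef) (hXP : (X₀⁻¹ - β • P).PosDef) :
    ∃ c : ℝ, 0 < c ∧ expMoment A B Q R β Pr x₀ w μ 0 P = ENNReal.ofReal c := by
  have h := lintegral_exp_quad_multivariateGaussian hX₀ (transpose_eq_of_posSemidef hP) hXP 0
  refine ⟨(√(1 - β • (P * X₀)).det)⁻¹ * Real.exp (β / 2 * quad (tildeP X₀ β P) 0),
    mul_pos (inv_pos.2 (Real.sqrt_pos.2 h.1)) (Real.exp_pos _), ?_⟩
  rw [← h.2, ← hx₀.map_eq, lintegral_map' (measurable_exp_quad β P 0).aemeasurable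
    hx₀.aemeasurable]
  refine lintegral_congr fun ω => ?_
  simp [costSum, noise, stateAt, history]

lemma finiteHorizonCost_eq (n : ℕ) :
    finiteHorizonCost A B Q R β Pr x₀ w μ n =
      ((1 / (n : ℝ) * (2 / β) : ℝ) : EReal) *
        ENNReal.log (expMoment A B Q R β Pr x₀ w μ n 0) := by
  simp [finiteHorizonCost, expMoment, costSum, noise, quad]

end Moments

/-! ### Bounds on the finite-horizon cost and passage to the limit. -/

lemma coe_mul_log_eq {r : ℝ} (hr : 0 < r) (c : ℝ) :
    ((c * Real.log r : ℝ) : EReal) = (c : EReal) * ENNReal.log (ENNReal.ofReal r) := by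
  rw [ENNReal.log_ofReal_of_pos hr, EReal.coe_mul]

lemma coe_mul_log_mono {c : ℝ} (hc : 0 ≤ c) {I J : ENNReal} (h : I ≤ J) :
    (c : EReal) * ENNReal.log I ≤ (c : EReal) * ENNReal.log J :=
  mul_le_mul_of_nonneg_left (ENNReal.log_le_log h) (EReal.coe_nonneg.2 hc)

lemma coe_mul_log_anti {c : ℝ} (hc : c ≤ 0) {I J : ENNReal} (h : I ≤ J) :
    (c : EReal) * ENNReal.log J ≤ (c : EReal) * ENNReal.log I := by
  rw [mul_comm (c : EReal), mul_comm (c : EReal)]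
  exact EReal.mul_le_mul_of_nonpos_right (ENNReal.log_le_log h) (EReal.coe_nonpos.2 hc)

section Main

variable {m d : ℕ} {A : Matrix (Fin m) (Fin m) ℝ} {B : Matrix (Fin m) (Fin d) ℝ}
  {Q : Matrix (Fin m) (Fin m) ℝ} {R : Matrix (Fin d) (Fin d) ℝ} {μ : Policy m d}
  {X₀ W P : Matrix (Fin m) (Fin m) ℝ} {β : ℝ}
  {Ω : Type*} [MeasurableSpace Ω] {Pr : Measure Ω}
  {x₀ : Ω → Vec m} {w : ℕ → Ω → Vec m}

lemma logDetValue_eq (hW : W.PosDef) (hP : Admissible W β P) :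
    logDetValue W β P = 2 / β * Real.log (noiseFactor W β P) := by
  rw [logDetValue, noiseFactor, Real.log_inv, Real.log_sqrt (det_pos_of_admissible hW hP).le]
  ring

lemma le_finiteHorizonCost (hβ : β ≠ 0) (hR : R.PosDef) (hW : W.PosDef) (hμ : μ.IsMeasurable)
    (hx₀ : AEMeasurable x₀ Pr) (hw : ∀ t, HasLaw (w t) (multivariateGaussian 0 W) Pr)
    (hindep : iIndepFun (fun i : Option ℕ => i.elim x₀ w) Pr)
    (hadm : ∀ k, Admissible W β (riccatiIter A B Q R W β k)) (n : ℕ) :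
    (((n : ℝ)⁻¹ * ∑ j ∈ Finset.range n, logDetValue W β (riccatiIter A B Q R W β j) : ℝ) : EReal) ≤
      finiteHorizonCost A B Q R β Pr x₀ w μ n := by
  have := hindep.isProbabilityMeasure
  have hpos : ∀ j, 0 < noiseFactor W β (riccatiIter A B Q R W β j) :=
    fun j => noiseFactor_pos hW (hadm j)
  have hprod : 0 < ∏ j ∈ Finset.range n, noiseFactor W β (riccatiIter A B Q R W β (0 + j)) :=
    Finset.prod_pos fun j _ => hpos _
  have hval : (n : ℝ)⁻¹ * ∑ j ∈ Finset.range n, logDetValue W β (riccatiIter A B Q R W β j) =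
      1 / (n : ℝ) * (2 / β) *
        Real.log (∏ j ∈ Finset.range n, noiseFactor W β (riccatiIter A B Q R W β (0 + j))) := by
    rw [Real.log_prod fun j _ => (hpos _).ne', Finset.sum_congr rfl fun j _ =>
      logDetValue_eq hW (hadm j), ← Finset.mul_sum]
    simp only [zero_add, one_div]
    ring
  rw [hval, coe_mul_log_eq hprod, finiteHorizonCost_eq]
  -- Since the iterates are positive semidefinite, the leftover initial moment is at most `1` for `β
  -- < 0` and at least `1` for `β > 0`; either way it can be discarded, even if infinite.
  rcases lt_or_gt_of_ne hβ with hb | hb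
  · refine coe_mul_log_anti
      (mul_nonpos_of_nonneg_of_nonpos (by positivity) (div_nonpos_of_nonneg_of_nonpos zero_le_two
        hb.le)) ((expMoment_le_prod hb hR hW hμ hx₀ hw hindep hadm n 0).trans ?_)
    exact mul_le_of_le_one_right' (expMoment_zero_le_one hb (hadm _).posSemidef)
  · refine coe_mul_log_mono (by positivity)
      (le_trans ?_ (expMoment_ge_prod hb hR hW hμ hx₀ hw hindep hadm n 0))
    exact le_mul_of_one_le_right' (expMoment_zero_ge_one hb (hadm _).posSemidef)

lemma tendsto_average_logDetValue (hβ : β ≠ 0) (hQ : Q.PosDef) (hR : R.PosDef) (hW : W.PosDef)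
    (hP : Admissible W β P) (hfix : riccatiMap A B Q R W β P = P)
    (hstab : IsStabilizing A B R W β P) :
    Tendsto (fun n : ℕ => (((n : ℝ)⁻¹ * ∑ j ∈ Finset.range n,
      logDetValue W β (riccatiIter A B Q R W β j) : ℝ) : EReal)) atTop
      (𝓝 (logDetValue W β P : EReal)) := by
  refine (continuous_coe_real_ereal.tendsto _).comp (Filter.Tendsto.cesaro ?_)
  have h1 : Continuous fun X : Matrix (Fin m) (Fin m) ℝ => (1 - β • (X * W)).det := by fun_prop
  have h2 := (h1.tendsto P).comp (tendsto_riccatiIter hβ hQ hR hW hP hfix hstab)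
  exact (h2.log (det_pos_of_admissible hW hP).ne').const_mul _

lemma finiteHorizonCost_linearFeedback_le (hβ : β ≠ 0) (hR : R.PosDef) (hX₀ : X₀.PosDef)
    (hW : W.PosDef) (hx₀ : HasLaw x₀ (multivariateGaussian 0 X₀) Pr)
    (hw : ∀ t, HasLaw (w t) (multivariateGaussian 0 W) Pr)
    (hindep : iIndepFun (fun i : Option ℕ => i.elim x₀ w) Pr)
    (hP : Admissible W β P) (hfix : riccatiMap A B Q R W β P = P)
    (hXP : (X₀⁻¹ - β • P).PosDef) :
    ∃ c : ℝ, ∀ n : ℕ, 1 ≤ n →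
      finiteHorizonCost A B Q R β Pr x₀ w (linearFeedback (riccatiGain A B R W β P)) n ≤
        ((logDetValue W β P + c / (n : ℝ) : ℝ) : EReal) := by
  obtain ⟨c, hc, hcI⟩ := exists_expMoment_zero_eq (A := A) (B := B) (Q := Q) (R := R)
    (μ := linearFeedback (riccatiGain A B R W β P)) (w := w) hX₀ hx₀ hP.posSemidef hXP
  -- Here `c` is the initial moment; its scaled logarithm is a fixed amount, spread over `n` stages.
  refine ⟨2 / β * Real.log c, fun n hn => ?_⟩
  have hD := noiseFactor_pos hW hP
  have hI := expMoment_linearFeedback (A := A) (B := B) (Q := Q) hβ hR hW hx₀.aemeasurable hw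
    hindep hP hfix n
  rw [hcI, ← ENNReal.ofReal_mul (pow_pos hD n).le] at hI
  have hn0 : (n : ℝ) ≠ 0 := by positivity
  have hval : logDetValue W β P + 2 / β * Real.log c / (n : ℝ) =
      1 / (n : ℝ) * (2 / β) * Real.log (noiseFactor W β P ^ n * c) := by
    rw [Real.log_mul (pow_pos hD n).ne' hc.ne', Real.log_pow, logDetValue_eq hW hP]
    field_simp
  rw [hval, coe_mul_log_eq (mul_pos (pow_pos hD n) hc), ← hI, finiteHorizonCost_eq]
  -- Replacing the terminal weight `P` by `0` lowers the cost for either sign of `β`.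
  rcases lt_or_gt_of_ne hβ with hb | hb
  · exact coe_mul_log_anti
      (mul_nonpos_of_nonneg_of_nonpos (by positivity) (div_nonpos_of_nonneg_of_nonpos zero_le_two
        hb.le)) (expMoment_terminal_ge hb hP.posSemidef n)
  · exact coe_mul_log_mono (by positivity) (expMoment_terminal_le hb hP.posSemidef n)

end Main

end LEQG

end

theorem lemmaE2 {m d : ℕ}
    (A : Matrix (Fin m) (Fin m) ℝ) (B : Matrix (Fin m) (Fin d) ℝ)
    (Q : Matrix (Fin m) (Fin m) ℝ) (hQ : Q.PosDef)
    (R : Matrix (Fin d) (Fin d) ℝ) (hR : R.PosDef)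
    (X₀ W : Matrix (Fin m) (Fin m) ℝ) (hX₀ : X₀.PosDef) (hW : W.PosDef)
    (β : ℝ) (hβ : β ≠ 0)
    {Ω : Type*} [MeasurableSpace Ω] (Pr : Measure Ω) [IsProbabilityMeasure Pr]
    (x₀ : Ω → LEQG.Vec m) (w : ℕ → Ω → LEQG.Vec m)
    (hx₀ : HasLaw x₀ (multivariateGaussian 0 X₀) Pr)
    (hw : ∀ t, HasLaw (w t) (multivariateGaussian 0 W) Pr)
    (hindep : iIndepFun (fun i : Option ℕ => i.elim x₀ w) Pr)
    (P : Matrix (Fin m) (Fin m) ℝ) (hP : P.PosSemidef)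
    (hfix : LEQG.IsRiccatiFixedPoint A B Q R W β P)
    (hstab : LEQG.IsStabilizing A B R W β P)
    (hWP : (W⁻¹ - β • P).PosDef) :
    (∀ (μ : LEQG.Policy m d) (J : EReal), μ.IsMeasurable →
      LEQG.HasObjective A B Q R β Pr x₀ w μ J → (LEQG.logDetValue W β P : EReal) ≤ J) ∧
    ((X₀⁻¹ - β • P).PosDef →
      LEQG.HasObjective A B Q R β Pr x₀ w
        (LEQG.linearFeedback (LEQG.riccatiGain A B R W β P)) (LEQG.logDetValue W β P : EReal) ∧
      IsLeast {J : EReal | ∃ μ : LEQG.Policy m d, μ.IsMeasurable ∧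
          LEQG.HasObjective A B Q R β Pr x₀ w μ J} (LEQG.logDetValue W β P : EReal)) := by
  have hPadm : LEQG.Admissible W β P := ⟨hP, hWP⟩
  have hPfix : LEQG.riccatiMap A B Q R W β P = P := hfix.symm
  have hadm := fun k =>
    (LEQG.riccatiIter_admissible_and_le (A := A) (B := B) (Q := Q) (R := R)
      hβ hQ hR hW hPadm hPfix k).1
  have hlim := LEQG.tendsto_average_logDetValue hβ hQ hR hW hPadm hPfix hstab
  have hlow : ∀ (μ : LEQG.Policy m d) (J : EReal), μ.IsMeasurable →
      LEQG.HasObjective A B Q R β Pr x₀ w μ J → (LEQG.logDetValue W β P : EReal) ≤ J :=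
    fun μ J hμ hJ => le_of_tendsto_of_tendsto' hlim hJ fun n =>
      LEQG.le_finiteHorizonCost hβ hR hW hμ hx₀.aemeasurable hw hindep hadm n
  refine ⟨hlow, fun hXP => ?_⟩
  have hK := LEQG.linearFeedback_isMeasurable (LEQG.riccatiGain A B R W β P)
  have hobj : LEQG.HasObjective A B Q R β Pr x₀ w
      (LEQG.linearFeedback (LEQG.riccatiGain A B R W β P)) (LEQG.logDetValue W β P : EReal) := by
    obtain ⟨c, hc⟩ := LEQG.finiteHorizonCost_linearFeedback_le (A := A) (B := B) (Q := Q)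
      hβ hR hX₀ hW hx₀ hw hindep hPadm hPfix hXP
    have hup : Tendsto (fun n : ℕ => ((LEQG.logDetValue W β P + c / (n : ℝ) : ℝ) : EReal)) atTop
        (𝓝 (LEQG.logDetValue W β P : EReal)) := by
      refine (continuous_coe_real_ereal.tendsto _).comp ?_
      simpa using (tendsto_const_div_atTop_nhds_zero_nat c).const_add (LEQG.logDetValue W β P)
    refine tendsto_of_tendsto_of_tendsto_of_le_of_le' hlim hup
      (Eventually.of_forall fun n =>
        LEQG.le_finiteHorizonCost hβ hR hW hK hx₀.aemeasurable hw hindep hadm n) ?_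
    filter_upwards [eventually_ge_atTop 1] with n hn
    exact hc n hn
  exact ⟨hobj, ⟨_, hK, hobj⟩, fun J ⟨μ, hμ, hJ⟩ => hlow μ J hμ hJ⟩
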